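/- **Setting.** Let $\boldsymbol k$ be a field, $n\ge 1$, $\lambda\in\boldsymbol k^{\times}$, and $V$ a finite-dimensional $\boldsymbol k$-vector space. Let $B_n$ be Artin's braid group and $P_n\subset B_n$ the pure braid group. Number the strands of $B_{n+1}$ by $0,\dots,n$ (generators $\sigma_0,\dots,\sigma_{n-1}$) and those of $B_n$ by $1,\dots,n$ (generators $\sigma_1,\dots,\sigma_{n-1}$). Put $\widetilde{\sigma_i}=\sigma_i^{-1}$ and, for $i<j$, $$\widetilde{\sigma_{ij}}=\widetilde{\sigma_i}\cdots\widetilde{\sigma_{j-2}}\,\widetilde{\sigma_{j-1}}^{\,2}\,(\widetilde{\sigma_i}\cdots\widetilde{\sigma_{j-2}})^{-1},\qquad \sigma_{ij}=\widetilde{\sigma_{ij}}^{\,-1}=\sigma_i^{-1}\cdots\sigma_{j-2}^{-1}\,\sigma_{j-1}^{2}\,(\sigma_i^{-1}\cdots\sigma_{j-2}^{-1})^{-1}.$$ Let $B_n$ act on the free group $F_n=\langle x_1,\dots,x_n\rangle$ from the left by $\theta_{\sigma_i}(x_i)=x_{i+1}$, $\theta_{\sigma_i}(x_{i+1})=x_{i+1}^{-1}x_ix_{i+1}$,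 $\theta_{\sigma_i}(x_j)=x_j$ for $j\ne i,i+1$. The group $P_{n+1}$ is identified with $F_n\rtimes P_n$ by the isomorphism $\sigma_{0j}\mapsto x_j$ and $\sigma_{ij}\mapsto\sigma_{ij}$ for $1\le i<j\le n$. **Twisted Long–Moody construction.** For $\rho\colon P_{n+1}=F_n\rtimes P_n\to \mathrm{GL}(V)$ put $g_j=\rho(x_j)$. The representation $\rho^{LM}_\lambda\colon F_n\rtimes P_n\to\mathrm{GL}(V^{\oplus n})$ is defined as follows. The matrix $\rho^{LM}_\lambda(x_i)$ is the identity matrix with its $i$-th block row replaced by $$\bigl(\lambda(g_1-1),\dots,\lambda(g_{i-1}-1),\ \lambda g_i,\ g_{i+1}-1,\dots,g_n-1\bigr).$$ For $b\in P_n$, let $D\colon F_n\to \mathrm{End}(V)^n$ be the map with $D(uv)=D(u)\rho(v)+D(v)$ and $D(x_j)=e_j$, the $j$-th unit vector; then $\rho^{LM}_\lambda(b)$ is the block matrix with $j$-th column $D(\theta_b(x_j))\,\rho(b)$. (For a representation of $F_n\rtimes B_n$ the same formula gives, with $s_i=\rho(\sigma_i)$, $\sigma_i\mapsto s_i^{\oplus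 n}\cdot\mathrm{diag}(1,\dots,1,R_i,1,\dots,1)$, where $R_i=\begin{pmatrix}0&g_i\\1&1-g_{i+1}\end{pmatrix}$ stands in rows and columns $i,i+1$.) **Haraoka's convolution.** Let $\eta\colon P_{n+1}\to\mathrm{GL}(V)$ be an anti-homomorphism and $M_{ij}=\eta(\widetilde{\sigma_{ij}})$ for $0\le i<j\le n$. Haraoka's convolution $\eta^{H}_\lambda\colon P_{n+1}\to\mathrm{GL}(V^{\oplus n})$ is the anti-homomorphism with $\eta^{H}_\lambda(\widetilde{\sigma_{ij}})=N_{ij}$ for $0\le i<j\le n$, where $N_{ij}$ is the following $n\times n$ block matrix with rows and columns numbered $1,\dots,n$. The matrix $N_{0j}$ is the identity matrix with its $j$-th row replaced by $$\bigl(\lambda(M_{01}-1),\dots,\lambda(M_{0,j-1}-1),\ \lambda M_{0j},\ M_{0,j+1}-1,\dots,M_{0n}-1\bigr).$$ For $i>0$ the nonzero blocks of $N_{ij}$ are, with $i<k<j$: - $(i,i)$: $M_{0j}M_{ij}$; $\quad(i,k)$: $(M_{0j}M_{ij}-M_{0i}^{-1}M_{ij}M_{0i})(1-M_{0k})$; $\quad(i,j)$: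 $M_{0j}M_{ij}(1-M_{0j})$; - $(j,i)$: $M_{ij}(1-M_{0i})$; $\quad(j,k)$: $M_{ij}(1-M_{0i})(1-M_{0k})$; $\quad(j,j)$: $M_{ij}-M_{ij}M_{0j}+M_{0j}M_{ij}M_{0i}$; - $(k,k)$: $M_{0i}^{-1}M_{ij}M_{0i}$; $\quad(l,l)$ for $l<i$ or $l>j$: $M_{ij}$. **Theorem.** For a homomorphism $\varphi$ of groups let $\varphi^{op}$ be the anti-homomorphism $g\mapsto\varphi(g^{-1})$. For every representation $\rho\colon P_{n+1}\to\mathrm{GL}(V)$, the convolution $(\rho^{op})^{H}_\lambda$ is well defined, that is, there is exactly one anti-homomorphism $P_{n+1}\to\mathrm{GL}(V^{\oplus n})$ that sends $\widetilde{\sigma_{ij}}$ to $N_{ij}$ for all $0\le i<j\le n$ (with $M_{ij}=\rho^{op}(\widetilde{\sigma_{ij}})$), and $$(\rho^{LM}_\lambda)^{op}=(\rho^{op})^{H}_\lambda .$$ -/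

import Mathlib

namespace HaraokaLong

/-! ### Braid groups -/

/-- Defining relators of the Artin braid group on `n` strands. The strands are labelled
`0, …, n - 1`, and the generators by the `i` with `i + 1 < n`; generator `i` exchanges the
strands `i` and `i + 1`. -/
def braidRels (n : ℕ) : Set (FreeGroup {i : ℕ // i + 1 < n}) :=
  {r | ∃ i j : {i : ℕ // i + 1 < n}, i.1 + 1 < j.1 ∧
      r = .of i * .of j * (.of j * .of i)⁻¹} ∪
  {r | ∃ i j : {i : ℕ // i + 1 < n}, j.1 = i.1 + 1 ∧
      r = .of i * .of j * .of i * (.of j * .of i * .of j)⁻¹}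

/-- Artin's braid group on `n` strands. -/
abbrev BraidGroup (n : ℕ) : Type := PresentedGroup (braidRels n)

/-- The Artin generator `σ_i` for `i + 1 < n` (and `1` for all other `i`, which never matter). -/
def sigma (n i : ℕ) : BraidGroup n :=
  if h : i + 1 < n then PresentedGroup.of ⟨i, h⟩ else 1

theorem sigma_comm {n i j : ℕ} (hij : i + 1 < j) :
    sigma n i * sigma n j = sigma n j * sigma n i := by
  unfold sigma
  split_ifs with hi hj <;> try simp
  exact PresentedGroup.mk_eq_mk_of_mul_inv_mem (Or.inl ⟨⟨i, hi⟩, ⟨j, hj⟩, hij, rfl⟩)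

theorem sigma_braid {n i : ℕ} (hi : i + 2 < n) :
    sigma n i * sigma n (i + 1) * sigma n i
      = sigma n (i + 1) * sigma n i * sigma n (i + 1) := by
  unfold sigma
  rw [dif_pos (by omega), dif_pos (by omega)]
  exact PresentedGroup.mk_eq_mk_of_mul_inv_mem
    (Or.inr ⟨⟨i, by omega⟩, ⟨i + 1, by omega⟩, rfl, rfl⟩)

/-- Universal property of the braid group. -/
def braidLift {G : Type*} [Group G] (n : ℕ) (f : ℕ → G)
    (h1 : ∀ i j, i + 1 < j → j + 1 < n → f i * f j = f j * f i)
    (h2 : ∀ i, i + 2 < n → f i * f (i + 1) * f i = f (i + 1) * f i * f (i + 1)) :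
    BraidGroup n →* G :=
  PresentedGroup.toGroup (f := fun i => f i.1) (by
    rintro r (⟨i, j, hij, rfl⟩ | ⟨i, j, hij, rfl⟩)
    · simp only [map_mul, map_inv, FreeGroup.lift_apply_of]
      rw [h1 _ _ hij j.2, mul_inv_cancel]
    · simp only [map_mul, map_inv, FreeGroup.lift_apply_of, hij]
      rw [h2 _ (by have := j.2; omega), mul_inv_cancel])

theorem braidLift_sigma {G : Type*} [Group G] {n : ℕ} {f : ℕ → G} {h1 h2} {i : ℕ}
    (hi : i + 1 < n) : braidLift n f h1 h2 (sigma n i) = f i := by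
  unfold braidLift sigma
  rw [dif_pos hi, PresentedGroup.toGroup.of]

theorem braid_mem {n : ℕ} (H : Subgroup (BraidGroup n))
    (h : ∀ i, i + 1 < n → sigma n i ∈ H) (b : BraidGroup n) : b ∈ H :=
  PresentedGroup.generated_by _ H (fun j => by
    have := h j.1 j.2
    unfold sigma at this
    rwa [dif_pos j.2] at this) b

/-- The adjacent transposition `(i, i + 1)` of `{0, …, n - 1}`. -/
def adjSwap (n i : ℕ) : Equiv.Perm (Fin n) :=
  if h : i + 1 < n then Equiv.swap ⟨i, by omega⟩ ⟨i + 1, h⟩ else 1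

theorem adjSwap_val {n i : ℕ} (h : i + 1 < n) (p : Fin n) :
    (adjSwap n i p).1 = if p.1 = i then i + 1 else if p.1 = i + 1 then i else p.1 := by
  unfold adjSwap
  rw [dif_pos h, Equiv.swap_apply_def]
  simp only [Fin.ext_iff]
  split_ifs <;> rfl

/-- The projection `σ_i ↦ (i, i + 1)` of the braid group onto the symmetric group. -/
def braidPerm (n : ℕ) : BraidGroup n →* Equiv.Perm (Fin n) :=
  braidLift n (adjSwap n)
    (fun i j hij hj => by
      ext p
      simp only [Equiv.Perm.mul_apply]
      rw [adjSwap_val (by omega), adjSwap_val (by omega), adjSwap_val (by omega),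
        adjSwap_val (by omega)]
      split_ifs <;> omega)
    (fun i hi => by
      ext p
      simp only [Equiv.Perm.mul_apply]
      simp only [adjSwap_val (show i + 1 < n by omega), adjSwap_val (show i + 1 + 1 < n by omega)]
      split_ifs <;> omega)

/-- The pure braid group, as a subgroup of the braid group. -/
def pureBraid (n : ℕ) : Subgroup (BraidGroup n) := (braidPerm n).ker

/-- For a sequence `s` in a group, the element
`s_i ⋯ s_{j-2} (s_{j-1})² (s_i ⋯ s_{j-2})⁻¹`, for `i < j`. -/
def band {G : Type*} [Group G] (s : ℕ → G) (i j : ℕ) : G :=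
  ((List.range' i (j - 1 - i)).map s).prod * s (j - 1) ^ 2 *
    (((List.range' i (j - 1 - i)).map s).prod)⁻¹

theorem sigma_sq_mem (n i : ℕ) : sigma n i ^ 2 ∈ pureBraid n := by
  unfold pureBraid
  rw [MonoidHom.mem_ker, map_pow]
  by_cases h : i + 1 < n
  · unfold braidPerm
    rw [braidLift_sigma h, adjSwap, dif_pos h, pow_two, Equiv.swap_mul_self]
  · rw [sigma, dif_neg h, map_one, one_pow]

theorem band_mem (n i j : ℕ) : band (fun k => (sigma n k)⁻¹) i j ∈ pureBraid n := by
  unfold band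
  have : (pureBraid n).Normal := by unfold pureBraid; infer_instance
  apply this.conj_mem
  rw [inv_pow]
  exact inv_mem (sigma_sq_mem n _)

/-- The generator `σ̃_{ij} = σ̃_i ⋯ σ̃_{j-2} (σ̃_{j-1})² (σ̃_i ⋯ σ̃_{j-2})⁻¹` of the pure braid
group, where `σ̃_k = σ_k⁻¹`. -/
def sigmaTilde (n i j : ℕ) : pureBraid n :=
  ⟨band (fun k => (sigma n k)⁻¹) i j, band_mem n i j⟩

/-- The generator
`σ_{ij} = σ̃_{ij}⁻¹ = σ_i⁻¹ ⋯ σ_{j-2}⁻¹ (σ_{j-1})² (σ_i⁻¹ ⋯ σ_{j-2}⁻¹)⁻¹`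
of the pure braid group. -/
def sigmaPure (n i j : ℕ) : pureBraid n := (sigmaTilde n i j)⁻¹

theorem coe_sigmaPure (n i j : ℕ) : (sigmaPure n i j : BraidGroup n) =
    ((List.range' i (j - 1 - i)).map fun k => (sigma n k)⁻¹).prod * sigma n (j - 1) ^ 2 *
      (((List.range' i (j - 1 - i)).map fun k => (sigma n k)⁻¹).prod)⁻¹ := by
  simp only [sigmaPure, sigmaTilde, band, Subgroup.coe_inv]
  group

/-! ### The Artin action -/

/-- The endomorphism `x_i ↦ x_{i+1}`, `x_{i+1} ↦ x_{i+1}⁻¹ x_i x_{i+1}`, `x_j ↦ x_j` otherwise. -/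
def artinFun (n i : ℕ) (h : i + 1 < n) : FreeGroup (Fin n) →* FreeGroup (Fin n) :=
  FreeGroup.lift fun j =>
    if j.1 = i then .of ⟨i + 1, h⟩
    else if j.1 = i + 1 then
      (.of ⟨i + 1, h⟩)⁻¹ * .of ⟨i, by omega⟩ * .of ⟨i + 1, h⟩
    else .of j

/-- The inverse of `artinFun`. -/
def artinInv (n i : ℕ) (h : i + 1 < n) : FreeGroup (Fin n) →* FreeGroup (Fin n) :=
  FreeGroup.lift fun j =>
    if j.1 = i then .of ⟨i, by omega⟩ * .of ⟨i + 1, h⟩ * (.of ⟨i, by omega⟩)⁻¹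
    else if j.1 = i + 1 then .of ⟨i, by omega⟩
    else .of j

/-- `artinFun` as an automorphism of the free group. -/
def artinGen (n i : ℕ) : MulAut (FreeGroup (Fin n)) :=
  if h : i + 1 < n then
    MonoidHom.toMulEquiv (artinFun n i h) (artinInv n i h)
      (by
        ext ⟨j, hj⟩
        simp only [artinFun, artinInv, MonoidHom.comp_apply, FreeGroup.lift_apply_of,
          MonoidHom.id_apply]
        split_ifs with h1 h2
        · subst h1; simp [mul_assoc]
        · subst h2; simp [mul_assoc]
        · simp [h1, h2])
      (by
        ext ⟨j, hj⟩
        simp only [artinFun, artinInv, MonoidHom.comp_apply, FreeGroup.lift_apply_of,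
          MonoidHom.id_apply]
        split_ifs with h1 h2
        · subst h1; simp [mul_assoc]
        · subst h2; simp [mul_assoc]
        · simp [h1, h2])
  else 1

theorem artinGen_of {n i : ℕ} (h : i + 1 < n) (j : Fin n) :
    artinGen n i (.of j) = if j.1 = i then .of ⟨i + 1, h⟩
    else if j.1 = i + 1 then
      (.of ⟨i + 1, h⟩)⁻¹ * .of ⟨i, by omega⟩ * .of ⟨i + 1, h⟩
    else .of j := by
  unfold artinGen
  rw [dif_pos h]
  exact FreeGroup.lift_apply_of

theorem mulAut_free_ext {n : ℕ} {a b : MulAut (FreeGroup (Fin n))}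
    (h : ∀ j, a (.of j) = b (.of j)) : a = b := by
  apply MulEquiv.toMonoidHom_injective
  ext j
  exact h j

/-- The Artin representation `θ : B_n → Aut(F_n)` (a left action). The generators
`x_1, …, x_n` of `F_n` and the strands `1, …, n` of `B_n` are indexed by `Fin n`, that is,
shifted down by one. -/
def artin (n : ℕ) : BraidGroup n →* MulAut (FreeGroup (Fin n)) :=
  braidLift n (artinGen n)
    (fun i j hij hj => by
      apply mulAut_free_ext
      rintro ⟨k, hk⟩
      have hi : i + 1 < n := by omega
      simp only [MulAut.mul_apply, artinGen_of hi, artinGen_of hj]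
      by_cases h1 : k = i
      · subst h1
        simp [artinGen_of hj, show k ≠ j by omega, show k ≠ j + 1 by omega,
          show k + 1 ≠ j by omega, artinGen_of hi]
      by_cases h2 : k = i + 1
      · subst h2
        simp [artinGen_of hj, show i ≠ j by omega, show i ≠ j + 1 by omega,
          show i + 1 ≠ j by omega, artinGen_of hi]
      by_cases h3 : k = j
      · subst h3
        simp [artinGen_of hi, h1, h2, artinGen_of hj, show k + 1 ≠ i by omega]
      by_cases h4 : k = j + 1
      · subst h4
        simp [artinGen_of hi, h1, artinGen_of hj,
          show j ≠ i by omega, show j ≠ i + 1 by omega]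
      simp [h1, h2, h3, h4, artinGen_of hi, artinGen_of hj])
    (fun i hi2 => by
      apply mulAut_free_ext
      rintro ⟨k, hk⟩
      have hi : i + 1 < n := by omega
      have hj : i + 1 + 1 < n := by omega
      have e1 : i + 1 + 1 ≠ i := by omega
      have e2 : i ≠ i + 1 + 1 := by omega
      simp only [MulAut.mul_apply, artinGen_of hi, artinGen_of hj]
      by_cases h1 : k = i
      · subst h1; simp [artinGen_of hi, artinGen_of hj, e1, e2]
      by_cases h2 : k = i + 1
      · subst h2; simp [artinGen_of hi, artinGen_of hj, e1, e2]
      by_cases h3 : k = i + 2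
      · subst h3; simp [artinGen_of hi, artinGen_of hj, e1, e2, mul_assoc]
      simp [h1, h2, h3, artinGen_of hi, artinGen_of hj])

theorem artin_sigma {n i : ℕ} (h : i + 1 < n) : artin n (sigma n i) = artinGen n i :=
  braidLift_sigma h

/-- The semidirect product `F_n ⋊ B` for a subgroup `B` of the braid group `B_n`. -/
abbrev FreeSemidirect (n : ℕ) (B : Subgroup (BraidGroup n)) : Type :=
  FreeGroup (Fin n) ⋊[(artin n).comp B.subtype] B

/-! ### The identification of `P_{n+1}` with `F_n ⋊ P_n` -/

/-- The coset representative `σ_{p-1} ⋯ σ_0`. -/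
def rep (m : ℕ) : ℕ → BraidGroup m
  | 0 => 1
  | p + 1 => sigma m p * rep m p

theorem rep_comm_lt {m p i : ℕ} (h : p < i) :
    sigma m i * rep m p = rep m p * sigma m i := by
  induction p with
  | zero => simp [rep]
  | succ p ih =>
    rw [rep, ← mul_assoc, ← sigma_comm h, mul_assoc, ih (by omega), mul_assoc]

theorem rep_comm_gt {m p i : ℕ} (h : i + 1 < p) (hp : p < m) :
    sigma m i * rep m p = rep m p * sigma m (i + 1) := by
  induction p, h using Nat.le_induction with
  | base =>
    simp only [rep]
    rw [← mul_assoc, ← mul_assoc, sigma_braid (by omega), mul_assoc, rep_comm_lt (by omega)]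
    simp only [mul_assoc]
  | succ p hp' ih =>
    rw [rep, ← mul_assoc, sigma_comm (by omega), mul_assoc, ih (by omega), mul_assoc]

/-- The element `r_j⁻¹ σ_j² r_j`, equal to `σ_{0,j+1}`. -/
def loop (m j : ℕ) : BraidGroup m := (rep m j)⁻¹ * sigma m j ^ 2 * rep m j

theorem prod_range_inv (m j : ℕ) :
    ((List.range' 0 j).map fun k => (sigma m k)⁻¹).prod = (rep m j)⁻¹ := by
  induction j with
  | zero => simp [rep]
  | succ j ih => simp [rep, List.range'_concat, ih]

theorem loop_eq (m j : ℕ) : loop m j = sigmaPure m 0 (j + 1) := by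
  rw [coe_sigmaPure, loop]
  simp [prod_range_inv]

theorem comm_of_rel {G : Type*} [Group G] {s t u : G} (h : s * t = t * s) (hu : s * u = u * s) :
    s * (u⁻¹ * t ^ 2 * u) * s⁻¹ = u⁻¹ * t ^ 2 * u := by
  have h1 : Commute s (u⁻¹ * t ^ 2 * u) :=
    ((Commute.inv_right hu).mul_right (Commute.pow_right h 2)).mul_right hu
  rw [h1.eq, mul_inv_cancel_right]

theorem loop_conj {m i j : ℕ} (hi : i + 2 < m) (hj : j + 1 < m) :
    sigma m (i + 1) * loop m j * (sigma m (i + 1))⁻¹ =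
      if j = i then loop m (i + 1)
      else if j = i + 1 then (loop m (i + 1))⁻¹ * loop m i * loop m (i + 1)
      else loop m j := by
  have hb := sigma_braid hi
  have hc : sigma m (i + 1) * rep m i = rep m i * sigma m (i + 1) := rep_comm_lt (by omega)
  split_ifs with h1 h2
  · subst h1
    simp only [loop, rep]
    generalize sigma m j = s at *
    generalize sigma m (j + 1) = u at *
    generalize rep m j = r at *
    have e : u * s ^ 2 * u⁻¹ = s⁻¹ * u ^ 2 * s := by
      have : s * (u * s ^ 2) = u ^ 2 * s * u := by
        calc s * (u * s ^ 2) = (s * u * s) * s := by simp only [pow_two, mul_assoc]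
          _ = (u * s * u) * s := by rw [hb]
          _ = u * (s * u * s) := by simp only [mul_assoc]
          _ = _ := by rw [hb]; simp only [pow_two, mul_assoc]
      rw [mul_inv_eq_iff_eq_mul, mul_assoc, mul_assoc, eq_inv_mul_iff_mul_eq, this, mul_assoc]
    have hc' : u * r⁻¹ = r⁻¹ * u := by
      rw [eq_inv_mul_iff_mul_eq, ← mul_assoc, ← hc, mul_inv_cancel_right]
    have hc2 : r * u⁻¹ = u⁻¹ * r := by
      rw [mul_inv_eq_iff_eq_mul, mul_assoc, ← hc, inv_mul_cancel_left]
    calc u * (r⁻¹ * s ^ 2 * r) * u⁻¹ = (u * r⁻¹) * s ^ 2 * (r * u⁻¹) := by group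
      _ = r⁻¹ * (u * s ^ 2 * u⁻¹) * r := by rw [hc', hc2]; group
      _ = _ := by rw [e]; group
  · subst h2
    simp only [loop, rep]
    generalize sigma m i = s at *
    generalize sigma m (i + 1) = u at *
    generalize rep m i = r at *
    have hc' : u * r⁻¹ = r⁻¹ * u := by
      rw [eq_inv_mul_iff_mul_eq, ← mul_assoc, ← hc, mul_inv_cancel_right]
    have hc2 : r * u⁻¹ = u⁻¹ * r := by
      rw [mul_inv_eq_iff_eq_mul, mul_assoc, ← hc, inv_mul_cancel_left]
    have key : u * (s⁻¹ * u ^ 2 * s) * u⁻¹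
        = (s⁻¹ * u ^ 2 * s)⁻¹ * s ^ 2 * (s⁻¹ * u ^ 2 * s) := by
      have e : s⁻¹ * u ^ 2 * s = u * s ^ 2 * u⁻¹ := by
        have : s * (u * s ^ 2) = u ^ 2 * s * u := by
          calc s * (u * s ^ 2) = (s * u * s) * s := by simp only [pow_two, mul_assoc]
            _ = (u * s * u) * s := by rw [hb]
            _ = u * (s * u * s) := by simp only [mul_assoc]
            _ = _ := by rw [hb]; simp only [pow_two, mul_assoc]
        rw [eq_mul_inv_iff_mul_eq, mul_assoc, mul_assoc, inv_mul_eq_iff_eq_mul, this, mul_assoc]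
      have c : (u * s ^ 2 * u) * s ^ 2 = s ^ 2 * (u * s ^ 2 * u) := by
        have l : (u * s ^ 2 * u) * s ^ 2 = (s * u * s) * (s * u * s) := by
          calc (u * s ^ 2 * u) * s ^ 2 = u * s * (s * u * s) * s := by
                simp only [pow_two, mul_assoc]
            _ = u * s * (u * s * u) * s := by rw [hb]
            _ = (u * s * u) * (s * u * s) := by simp only [mul_assoc]
            _ = _ := by rw [← hb]
        have l2 : s ^ 2 * (u * s ^ 2 * u) = (s * u * s) * (s * u * s) := by
          calc s ^ 2 * (u * s ^ 2 * u) = s * (s * u * s) * (s * u) := by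
                simp only [pow_two, mul_assoc]
            _ = s * (u * s * u) * (s * u) := by rw [hb]
            _ = (s * u * s) * (u * s * u) := by simp only [mul_assoc]
            _ = _ := by rw [← hb]
        rw [l, l2]
      rw [e]
      rw [mul_assoc (u * s ^ 2 * u⁻¹)⁻¹, eq_inv_mul_iff_mul_eq]
      have : (u * s ^ 2 * u⁻¹) * (u * (u * s ^ 2 * u⁻¹) * u⁻¹)
          = (u * s ^ 2 * u) * s ^ 2 * (u⁻¹ * u⁻¹) := by group
      rw [this, c]; group
    calc u * ((s * r)⁻¹ * u ^ 2 * (s * r)) * u⁻¹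
        = (u * r⁻¹) * (s⁻¹ * u ^ 2 * s) * (r * u⁻¹) := by group
      _ = r⁻¹ * (u * (s⁻¹ * u ^ 2 * s) * u⁻¹) * r := by rw [hc', hc2]; group
      _ = _ := by rw [key]; group
  · rcases Nat.lt_or_gt_of_ne h1 with h | h
    · exact comm_of_rel (sigma_comm (by omega)).symm (rep_comm_lt (by omega))
    · have hg : sigma m i * rep m j = rep m j * sigma m (i + 1) :=
        rep_comm_gt (by omega) (by omega)
      have hs : Commute (sigma m i) (sigma m j ^ 2) :=
        Commute.pow_right (sigma_comm (by omega)) 2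
      have e : sigma m (i + 1) = (rep m j)⁻¹ * sigma m i * rep m j := by
        rw [mul_assoc, hg, inv_mul_cancel_left]
      rw [e, loop]
      calc _ = (rep m j)⁻¹ * (sigma m i * sigma m j ^ 2) * (sigma m i)⁻¹ * rep m j := by group
        _ = _ := by rw [hs.eq]; group

/-- The embedding `σ_i ↦ σ_{i+1}` of `B_n` into `B_{n+1}` that adds a strand on the left. -/
def shift (n : ℕ) : BraidGroup n →* BraidGroup (n + 1) :=
  braidLift n (fun i => sigma (n + 1) (i + 1))
    (fun _ _ hij _ => sigma_comm (by omega)) (fun _ _ => sigma_braid (by omega))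

theorem shift_sigma {n i : ℕ} (h : i + 1 < n) :
    shift n (sigma n i) = sigma (n + 1) (i + 1) := braidLift_sigma h

/-- The homomorphism `F_n → B_{n+1}`, `x_j ↦ σ_{0j}`. -/
def freeToBraid (n : ℕ) : FreeGroup (Fin n) →* BraidGroup (n + 1) :=
  FreeGroup.lift fun j => loop (n + 1) j.1

theorem freeToBraid_of {n : ℕ} (j : Fin n) : freeToBraid n (.of j) = loop (n + 1) j.1 :=
  FreeGroup.lift_apply_of

theorem freeToBraid_artin {n : ℕ} (b : BraidGroup n) (w : FreeGroup (Fin n)) :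
    freeToBraid n (artin n b w) = shift n b * freeToBraid n w * (shift n b)⁻¹ := by
  let H : Subgroup (BraidGroup n) :=
    { carrier := {b | ∀ w, freeToBraid n (artin n b w)
        = shift n b * freeToBraid n w * (shift n b)⁻¹}
      one_mem' := by intro w; simp
      mul_mem' := by
        intro a b ha hb w
        rw [map_mul, MulAut.mul_apply, ha, hb, map_mul]; group
      inv_mem' := by
        intro a ha w
        have := ha (artin n a⁻¹ w)
        rw [← MulAut.mul_apply, ← map_mul, mul_inv_cancel, map_one, MulAut.one_apply] at this
        rw [this]; simp [mul_assoc] }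
  refine braid_mem H (fun i hi w => ?_) b w
  rw [artin_sigma hi, shift_sigma hi]
  have : (freeToBraid n).comp (artinGen n i).toMonoidHom
      = (MulAut.conj (sigma (n + 1) (i + 1))).toMonoidHom.comp (freeToBraid n) := by
    ext j
    have hl := loop_conj (m := n + 1) (i := i) (j := j.1) (by omega) (by omega)
    simp only [MonoidHom.comp_apply, MulEquiv.coe_toMonoidHom, MulAut.conj_apply]
    rw [artinGen_of hi, freeToBraid_of, hl]
    split_ifs <;> simp [freeToBraid_of]
  exact DFunLike.congr_fun this w

/-- The homomorphism `F_n ⋊ B_n → B_{n+1}`. -/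
def semiToBraid (n : ℕ) : FreeGroup (Fin n) ⋊[artin n] BraidGroup n →* BraidGroup (n + 1) :=
  SemidirectProduct.lift (freeToBraid n) (shift n) (fun b => by
    ext j
    simp only [MonoidHom.comp_apply, MulEquiv.coe_toMonoidHom, MulAut.conj_apply]
    exact freeToBraid_artin b _)

/-- The generator `x_j` of `F_n`, as an element of `F_n ⋊ B_n`. -/
def genX (n j : ℕ) : FreeGroup (Fin n) ⋊[artin n] BraidGroup n :=
  if h : j < n then SemidirectProduct.inl (.of ⟨j, h⟩) else 1

/-- The generator `σ_i` of `B_n`, as an element of `F_n ⋊ B_n`. -/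
def genS (n i : ℕ) : FreeGroup (Fin n) ⋊[artin n] BraidGroup n :=
  SemidirectProduct.inr (sigma n i)

theorem genS_mul_genX {n i j : ℕ} (h : i + 1 < n) (h1 : j ≠ i) (h2 : j ≠ i + 1) :
    genS n i * genX n j = genX n j * genS n i := by
  unfold genX
  split_ifs with hj
  · rw [← mul_inv_eq_iff_eq_mul, genS, ← map_inv, ← SemidirectProduct.inl_aut, artin_sigma h,
      artinGen_of h, if_neg h1, if_neg h2]
  · simp

theorem genS_mul_genX_self {n i : ℕ} (h : i + 1 < n) :
    genS n i * genX n i = genX n (i + 1) * genS n i := by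
  unfold genX
  rw [dif_pos h, dif_pos (by omega), ← mul_inv_eq_iff_eq_mul, genS, ← map_inv,
    ← SemidirectProduct.inl_aut, artin_sigma h, artinGen_of h, if_pos rfl]

theorem genS_mul_genX_succ {n i : ℕ} (h : i + 1 < n) :
    genS n i * (genX n i * genX n (i + 1)) = genX n i * genX n (i + 1) * genS n i := by
  have h3 : genS n i * genX n (i + 1) =
      (genX n (i + 1))⁻¹ * genX n i * genX n (i + 1) * genS n i := by
    unfold genX
    rw [dif_pos h, dif_pos (by omega), ← mul_inv_eq_iff_eq_mul, genS, ← map_inv,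
      ← SemidirectProduct.inl_aut, artin_sigma h, artinGen_of h]
    simp
  rw [← mul_assoc, genS_mul_genX_self h, mul_assoc, h3]; group

theorem genS_comm {n i j : ℕ} (h : i + 1 < j) :
    genS n i * genS n j = genS n j * genS n i := by
  unfold genS; rw [← map_mul, sigma_comm h, map_mul]

theorem genS_braid {n i : ℕ} (h : i + 2 < n) :
    genS n i * genS n (i + 1) * genS n i = genS n (i + 1) * genS n i * genS n (i + 1) := by
  unfold genS; simp only [← map_mul]; rw [sigma_braid h]

/-- The permutation of `ℕ × (F_n ⋊ B_n)` by which `σ_i ∈ B_{n+1}` acts on pairs `(p, g)`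
(standing for the braid `r_p · g`). -/
def cosetGen (n i : ℕ) : Equiv.Perm (ℕ × (FreeGroup (Fin n) ⋊[artin n] BraidGroup n)) where
  toFun q :=
    if q.1 = i then (i + 1, q.2)
    else if q.1 = i + 1 then (i, genX n i * q.2)
    else if q.1 < i then (q.1, genS n (i - 1) * q.2)
    else if q.1 ≤ n then (q.1, genS n i * q.2)
    else q
  invFun q :=
    if q.1 = i then (i + 1, (genX n i)⁻¹ * q.2)
    else if q.1 = i + 1 then (i, q.2)
    else if q.1 < i then (q.1, (genS n (i - 1))⁻¹ * q.2)
    else if q.1 ≤ n then (q.1, (genS n i)⁻¹ * q.2)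
    else q
  left_inv := by
    rintro ⟨p, g⟩
    dsimp only
    split_ifs <;> simp_all
  right_inv := by
    rintro ⟨p, g⟩
    dsimp only
    split_ifs <;> simp_all

theorem cosetGen_apply (n i p : ℕ) (g : FreeGroup (Fin n) ⋊[artin n] BraidGroup n) :
    cosetGen n i (p, g) =
    if p = i then (i + 1, g)
    else if p = i + 1 then (i, genX n i * g)
    else if p < i then (p, genS n (i - 1) * g)
    else if p ≤ n then (p, genS n i * g)
    else (p, g) := rfl

theorem cosetGen_comm {n i j : ℕ} (hij : i + 1 < j) (hj : j + 1 < n + 1) :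
    cosetGen n i * cosetGen n j = cosetGen n j * cosetGen n i := by
  ext1 ⟨p, g⟩
  simp only [Equiv.Perm.mul_apply]
  obtain ⟨j, rfl⟩ : ∃ k, j = k + 1 := ⟨j - 1, by omega⟩
  by_cases h1 : p = i
  · subst h1
    simp [cosetGen_apply, show p ≠ j by omega, show p < j + 1 by omega,
      show p ≠ j + 1 by omega, show p ≠ j + 1 + 1 by omega, show p < j by omega]
  by_cases h2 : p = i + 1
  · subst h2
    have := genS_mul_genX (n := n) (i := j) (j := i) (by omega) (by omega) (by omega)
    simp [cosetGen_apply, show i ≠ j by omega, show i < j + 1 by omega,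
      show i ≠ j + 1 by omega, show i ≠ j + 1 + 1 by omega, show i < j by omega]
    rw [← mul_assoc, ← this, mul_assoc]
  by_cases h3 : p = j + 1
  · subst h3
    simp [cosetGen_apply, show j ≠ i by omega, show j + 1 ≠ i by omega, show ¬ j + 1 < i by omega,
      show j + 1 ≤ n by omega, show j + 1 + 1 ≠ i by omega, show ¬ j + 1 + 1 < i by omega,
      show j + 1 + 1 ≤ n by omega]
  by_cases h4 : p = j + 2
  · subst h4
    have := genS_mul_genX (n := n) (i := i) (j := j + 1) (by omega) (by omega) (by omega)
    simp [cosetGen_apply, show j ≠ i by omega, show j + 1 ≠ i by omega, show ¬ j + 1 < i by omega,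
      show j + 1 ≤ n by omega, show j + 2 ≠ i by omega, show ¬ j + 2 < i by omega,
      show j + 2 ≤ n by omega]
    rw [← mul_assoc, this, mul_assoc]
  by_cases h5 : p < i
  · have := genS_comm (n := n) (i := i - 1) (j := j) (by omega)
    simp [cosetGen_apply, h1, h2, h3, h4, h5, show p < j + 1 by omega]
    rw [← mul_assoc, this, mul_assoc]
  by_cases h6 : p < j + 1
  · have := genS_comm (n := n) (i := i) (j := j) (by omega)
    simp [cosetGen_apply, h1, h2, h3, h4, h5, h6, show p ≤ n by omega]
    rw [← mul_assoc, this, mul_assoc]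
  by_cases h7 : p ≤ n
  · have := genS_comm (n := n) (i := i) (j := j + 1) (by omega)
    simp [cosetGen_apply, h1, h2, h3, h4, h5, h6, h7]
    rw [← mul_assoc, this, mul_assoc]
  simp [cosetGen_apply, h1, h2, h3, h4, h5, h6, h7]

theorem cosetGen_braid {n i : ℕ} (hi : i + 2 < n + 1) :
    cosetGen n i * cosetGen n (i + 1) * cosetGen n i
      = cosetGen n (i + 1) * cosetGen n i * cosetGen n (i + 1) := by
  ext1 ⟨p, g⟩
  simp only [Equiv.Perm.mul_apply]
  have e1 : i + 1 + 1 ≠ i := by omega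
  have e2 : i ≠ i + 1 + 1 := by omega
  have e3 : ¬ i + 1 + 1 < i := by omega
  have e4 : i + 1 + 1 ≤ n := by omega
  by_cases h1 : p = i
  · subst h1
    simp [cosetGen_apply, e1, e2, e3, e4]
  by_cases h2 : p = i + 1
  · subst h2
    have := genS_mul_genX_self (n := n) (i := i) (by omega)
    simp [cosetGen_apply, e1, e2, e3, e4]
    rw [← mul_assoc, this, mul_assoc]
  by_cases h3 : p = i + 2
  · subst h3
    have := genS_mul_genX_succ (n := n) (i := i) (by omega)
    simp [cosetGen_apply, e1, e2, e3, e4]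
    simp only [← mul_assoc] at this ⊢
    rw [this]
  by_cases h5 : p < i
  · have := genS_braid (n := n) (i := i - 1) (by omega)
    rw [Nat.sub_add_cancel (by omega)] at this
    simp [cosetGen_apply, h1, h2, h3, h5, show p < i + 1 by omega]
    simp only [← mul_assoc]; rw [this]
  have h6 : ¬ p < i + 1 := by omega
  by_cases h7 : p ≤ n
  · have := genS_braid (n := n) (i := i) (by omega)
    simp [cosetGen_apply, h1, h2, h3, h5, h6, h7]
    simp only [← mul_assoc]; rw [this]
  simp [cosetGen_apply, h1, h2, h3, h5, h6, h7]

/-- The action of `B_{n+1}` on pairs `(p, g)`. -/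
def cosetAct (n : ℕ) :
    BraidGroup (n + 1) →* Equiv.Perm (ℕ × (FreeGroup (Fin n) ⋊[artin n] BraidGroup n)) :=
  braidLift (n + 1) (cosetGen n) (fun _ _ h1 h2 => cosetGen_comm h1 h2)
    (fun _ h => cosetGen_braid h)

theorem cosetAct_sigma {n i : ℕ} (h : i < n) :
    cosetAct n (sigma (n + 1) i) = cosetGen n i := braidLift_sigma (by omega)

theorem cosetAct_inv_eq {n : ℕ} (a : BraidGroup (n + 1))
    (q : ℕ × (FreeGroup (Fin n) ⋊[artin n] BraidGroup n)) :
    cosetAct n a (cosetAct n a⁻¹ q) = q := by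
  rw [← Equiv.Perm.mul_apply, ← map_mul, mul_inv_cancel, map_one]; rfl

theorem cosetAct_le {n : ℕ} (b : BraidGroup (n + 1))
    (q : ℕ × (FreeGroup (Fin n) ⋊[artin n] BraidGroup n)) :
    (cosetAct n b q).1 ≤ n ↔ q.1 ≤ n := by
  let H : Subgroup (BraidGroup (n + 1)) :=
    { carrier := {b | ∀ q, (cosetAct n b q).1 ≤ n ↔ q.1 ≤ n}
      one_mem' := by intro q; simp
      mul_mem' := by
        intro a b ha hb q
        rw [map_mul, Equiv.Perm.mul_apply, ha, hb]
      inv_mem' := by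
        intro a ha q
        rw [← ha, cosetAct_inv_eq] }
  refine braid_mem H (fun i hi => ?_) b q
  rintro ⟨p, g⟩
  rw [cosetAct_sigma (by omega), cosetGen_apply]
  dsimp only
  split_ifs <;> simp <;> omega

theorem cosetAct_fst {n : ℕ} (b : BraidGroup (n + 1))
    (q : ℕ × (FreeGroup (Fin n) ⋊[artin n] BraidGroup n)) (hq : q.1 < n + 1) :
    (cosetAct n b q).1 = (braidPerm (n + 1) b ⟨q.1, hq⟩).1 := by
  let H : Subgroup (BraidGroup (n + 1)) :=
    { carrier := {b | ∀ q : ℕ × (FreeGroup (Fin n) ⋊[artin n] BraidGroup n),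
        ∀ hq : q.1 < n + 1, (cosetAct n b q).1 = (braidPerm (n + 1) b ⟨q.1, hq⟩).1}
      one_mem' := by intro q hq; simp
      mul_mem' := by
        intro a b ha hb q hq
        have h := Nat.lt_succ_of_le ((cosetAct_le b q).2 (Nat.le_of_lt_succ hq))
        rw [map_mul, map_mul, Equiv.Perm.mul_apply, Equiv.Perm.mul_apply, ha _ h]
        congr 2
        exact Fin.ext (hb q hq)
      inv_mem' := by
        intro a ha q hq
        have h := Nat.lt_succ_of_le ((cosetAct_le a⁻¹ q).2 (Nat.le_of_lt_succ hq))
        have h2 := ha _ h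
        rw [cosetAct_inv_eq] at h2
        have h3 : (⟨q.1, hq⟩ : Fin (n + 1)) = braidPerm (n + 1) a ⟨_, h⟩ := Fin.ext h2
        rw [h3, ← Equiv.Perm.mul_apply, ← map_mul, inv_mul_cancel, map_one]; rfl }
  refine braid_mem H (fun i hi => ?_) b q hq
  rintro ⟨p, g⟩ hq
  rw [cosetAct_sigma (by omega), cosetGen_apply, braidPerm, braidLift_sigma hi, adjSwap_val hi]
  dsimp only
  split_ifs <;> rfl

/-- The braid `r_p · g` that a pair `(p, g)` stands for. -/
def pairBraid (n : ℕ) (q : ℕ × (FreeGroup (Fin n) ⋊[artin n] BraidGroup n)) :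
    BraidGroup (n + 1) := rep (n + 1) q.1 * semiToBraid n q.2

theorem semiToBraid_genX {n j : ℕ} (h : j < n) : semiToBraid n (genX n j) = loop (n + 1) j := by
  rw [genX, dif_pos h, semiToBraid, SemidirectProduct.lift_inl, freeToBraid_of]

theorem semiToBraid_genS {n i : ℕ} (h : i + 1 < n) :
    semiToBraid n (genS n i) = sigma (n + 1) (i + 1) := by
  rw [genS, semiToBraid, SemidirectProduct.lift_inr, shift_sigma h]

theorem pairBraid_cosetAct {n : ℕ} (b : BraidGroup (n + 1))
    (q : ℕ × (FreeGroup (Fin n) ⋊[artin n] BraidGroup n)) (hq : q.1 ≤ n) :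
    pairBraid n (cosetAct n b q) = b * pairBraid n q := by
  let H : Subgroup (BraidGroup (n + 1)) :=
    { carrier := {b | ∀ q : ℕ × (FreeGroup (Fin n) ⋊[artin n] BraidGroup n),
        q.1 ≤ n → pairBraid n (cosetAct n b q) = b * pairBraid n q}
      one_mem' := by intro q hq; simp
      mul_mem' := by
        intro a b ha hb q hq
        rw [map_mul, Equiv.Perm.mul_apply, ha _ ((cosetAct_le b q).2 hq), hb _ hq, mul_assoc]
      inv_mem' := by
        intro a ha q hq
        rw [eq_inv_mul_iff_mul_eq, ← ha _ ((cosetAct_le a⁻¹ q).2 hq), cosetAct_inv_eq] }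
  refine braid_mem H (fun i hi => ?_) b q hq
  rintro ⟨p, g⟩ hq
  dsimp only at hq
  rw [cosetAct_sigma (by omega), cosetGen_apply]
  split_ifs with h1 h2 h3
  · subst h1
    simp only [pairBraid, rep, mul_assoc]
  · subst h2
    simp only [pairBraid, rep, map_mul]
    rw [semiToBraid_genX (by omega), loop]
    simp only [pow_two, mul_assoc, mul_inv_cancel_left]
  · simp only [pairBraid, map_mul]
    rw [semiToBraid_genS (by omega), Nat.sub_add_cancel (by omega), ← mul_assoc, ← mul_assoc,
      rep_comm_lt h3]
  · simp only [pairBraid, map_mul]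
    rw [semiToBraid_genS (by omega), ← mul_assoc, ← mul_assoc,
      rep_comm_gt (by omega) (by omega)]

theorem cosetAct_mul_right {n : ℕ} (b : BraidGroup (n + 1))
    (q : ℕ × (FreeGroup (Fin n) ⋊[artin n] BraidGroup n))
    (h : FreeGroup (Fin n) ⋊[artin n] BraidGroup n) :
    cosetAct n b (q.1, q.2 * h) = ((cosetAct n b q).1, (cosetAct n b q).2 * h) := by
  let H : Subgroup (BraidGroup (n + 1)) :=
    { carrier := {b | ∀ q : ℕ × (FreeGroup (Fin n) ⋊[artin n] BraidGroup n),
        cosetAct n b (q.1, q.2 * h) = ((cosetAct n b q).1, (cosetAct n b q).2 * h)}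
      one_mem' := by intro q; simp
      mul_mem' := by
        intro a b ha hb q
        rw [map_mul, Equiv.Perm.mul_apply, Equiv.Perm.mul_apply, hb, ha]
      inv_mem' := by
        intro a ha q
        have := ha (cosetAct n a⁻¹ q)
        rw [cosetAct_inv_eq] at this
        rw [← this, ← Equiv.Perm.mul_apply, ← map_mul, inv_mul_cancel, map_one]; rfl }
  refine braid_mem H (fun i hi => ?_) b q
  rintro ⟨p, g⟩
  rw [cosetAct_sigma (by omega), cosetGen_apply, cosetGen_apply]
  dsimp only
  split_ifs <;> simp [mul_assoc]

/-- The component of a braid in `F_n ⋊ B_n` with respect to the coset of strand `0`. -/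
def kappa (n : ℕ) (b : BraidGroup (n + 1)) : FreeGroup (Fin n) ⋊[artin n] BraidGroup n :=
  (cosetAct n b (0, 1)).2

theorem kappa_mul {n : ℕ} (a b : BraidGroup (n + 1)) (hb : (cosetAct n b (0, 1)).1 = 0) :
    kappa n (a * b) = kappa n a * kappa n b := by
  have h : cosetAct n b (0, 1) = (0, 1 * kappa n b) := Prod.ext hb (by simp [kappa])
  rw [kappa, map_mul, Equiv.Perm.mul_apply, h]
  exact congrArg Prod.snd (cosetAct_mul_right a (0, 1) (kappa n b))

theorem semiToBraid_kappa {n : ℕ} (b : BraidGroup (n + 1)) (hb : (cosetAct n b (0, 1)).1 = 0) :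
    semiToBraid n (kappa n b) = b := by
  have := pairBraid_cosetAct b (0, 1) (Nat.zero_le n)
  rw [pairBraid, hb, pairBraid] at this
  simpa [rep, kappa] using this

theorem cosetAct_loop {n j : ℕ} (h : j < n) :
    cosetAct n (loop (n + 1) j) (0, 1) = (0, genX n j) := by
  induction j with
  | zero =>
    simp [loop, rep, pow_two, cosetAct_sigma h, cosetGen_apply]
  | succ j ih =>
    have hl := loop_conj (m := n + 1) (i := j) (j := j) (by omega) (by omega)
    rw [if_pos rfl] at hl
    have h0 : cosetAct n (sigma (n + 1) (j + 1))⁻¹ (0, 1) = (0, (genS n j)⁻¹) := by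
      rw [map_inv, cosetAct_sigma h, Equiv.Perm.inv_eq_iff_eq]
      simp [cosetGen_apply]
    have h1 := cosetAct_mul_right (loop (n + 1) j) (0, 1) (genS n j)⁻¹
    rw [ih (by omega), one_mul] at h1
    rw [← hl, map_mul, map_mul, Equiv.Perm.mul_apply, Equiv.Perm.mul_apply, h0, h1,
      cosetAct_sigma h, cosetGen_apply]
    simp only [Nat.add_sub_cancel]
    simp
    rw [← mul_assoc, genS_mul_genX_self h, mul_inv_cancel_right]

theorem cosetAct_semiToBraid {n : ℕ} (g : FreeGroup (Fin n) ⋊[artin n] BraidGroup n) :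
    cosetAct n (semiToBraid n g) (0, 1) = (0, g) := by
  let H : Subgroup (FreeGroup (Fin n) ⋊[artin n] BraidGroup n) :=
    { carrier := {g | ∀ h, cosetAct n (semiToBraid n g) (0, h) = (0, g * h)}
      one_mem' := by intro q; simp
      mul_mem' := by
        intro a b ha hb q
        rw [map_mul, map_mul, Equiv.Perm.mul_apply, hb, ha, mul_assoc]
      inv_mem' := by
        intro a ha q
        have := ha (a⁻¹ * q)
        rw [mul_inv_cancel_left] at this
        rw [← this, ← Equiv.Perm.mul_apply, ← map_mul, ← map_mul, inv_mul_cancel, map_one,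
          map_one]; rfl }
  have hX : ∀ w : FreeGroup (Fin n), SemidirectProduct.inl w ∈ H := by
    intro w
    induction w with
    | C1 => rw [map_one]; exact H.one_mem
    | of j =>
      intro h
      have h1 := cosetAct_mul_right (loop (n + 1) j.1) (0, 1) h
      rw [cosetAct_loop j.2, one_mul, genX, dif_pos j.2] at h1
      rw [semiToBraid, SemidirectProduct.lift_inl, freeToBraid_of, h1]
    | inv_of j hj => rw [map_inv]; exact H.inv_mem hj
    | mul a b ha hb => rw [map_mul]; exact H.mul_mem ha hb
  have hS : ∀ b : BraidGroup n, SemidirectProduct.inr b ∈ H := by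
    intro b
    refine braid_mem (H.comap SemidirectProduct.inr) (fun i hi => ?_) b
    intro h
    have := semiToBraid_genS hi
    rw [genS] at this
    rw [this, cosetAct_sigma (by omega), cosetGen_apply]
    simp [genS]
  have := SemidirectProduct.inl_left_mul_inr_right g
  have hg : g ∈ H := this ▸ H.mul_mem (hX _) (hS _)
  simpa using hg 1

/-- The braid attached to `(w, b) ∈ F_n ⋊ B_n` fixes strand `0` and permutes the others as `b`. -/
theorem braidPerm_semiToBraid {n : ℕ} (g : FreeGroup (Fin n) ⋊[artin n] BraidGroup n)
    (p : Fin n) :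
    braidPerm (n + 1) (semiToBraid n g) p.succ = (braidPerm n g.right p).succ := by
  let H : Subgroup (FreeGroup (Fin n) ⋊[artin n] BraidGroup n) :=
    { carrier := {g | ∀ p : Fin n,
        braidPerm (n + 1) (semiToBraid n g) p.succ = (braidPerm n g.right p).succ}
      one_mem' := by intro q; simp
      mul_mem' := by
        intro a b ha hb q
        rw [map_mul, map_mul, Equiv.Perm.mul_apply, hb, ha, SemidirectProduct.mul_right, map_mul,
          Equiv.Perm.mul_apply]
      inv_mem' := by
        intro a ha q
        rw [map_inv, map_inv, Equiv.Perm.inv_eq_iff_eq, ha, SemidirectProduct.inv_right, map_inv,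
          ← Equiv.Perm.mul_apply, mul_inv_cancel]; rfl }
  have hX : ∀ w : FreeGroup (Fin n), SemidirectProduct.inl w ∈ H := by
    intro w p
    have : freeToBraid n w ∈ pureBraid (n + 1) := by
      induction w with
      | C1 => rw [map_one]; exact Subgroup.one_mem _
      | of j => rw [freeToBraid_of, loop_eq]; exact (sigmaPure _ _ _).2
      | inv_of j hj => rw [map_inv]; exact Subgroup.inv_mem _ hj
      | mul a b ha hb => rw [map_mul]; exact Subgroup.mul_mem _ ha hb
    rw [semiToBraid, SemidirectProduct.lift_inl, MonoidHom.mem_ker.1 this]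
    simp
  have hS : ∀ b : BraidGroup n, SemidirectProduct.inr b ∈ H := by
    intro b
    refine braid_mem (H.comap SemidirectProduct.inr) (fun i hi => ?_) b
    intro p
    have := semiToBraid_genS hi
    rw [genS] at this
    rw [this, SemidirectProduct.right_inr, braidPerm, braidLift_sigma (by omega), braidPerm,
      braidLift_sigma hi]
    ext
    rw [adjSwap_val (by omega), Fin.val_succ, Fin.val_succ, adjSwap_val hi]
    split_ifs <;> omega
  have := SemidirectProduct.inl_left_mul_inr_right g
  have hg : g ∈ H := this ▸ H.mul_mem (hX _) (hS _)
  exact hg p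

theorem cosetAct_pure {n : ℕ} {b : BraidGroup (n + 1)} (hb : b ∈ pureBraid (n + 1)) :
    (cosetAct n b (0, 1)).1 = 0 := by
  rw [cosetAct_fst b (0, 1) (Nat.succ_pos n), MonoidHom.mem_ker.1 hb]; rfl

theorem kappa_right_mem {n : ℕ} {b : BraidGroup (n + 1)} (hb : b ∈ pureBraid (n + 1)) :
    (kappa n b).right ∈ pureBraid n := by
  refine MonoidHom.mem_ker.2 (Equiv.ext fun p => Fin.succ_injective _ ?_)
  rw [← braidPerm_semiToBraid, semiToBraid_kappa b (cosetAct_pure hb), MonoidHom.mem_ker.1 hb]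
  rfl

/-- The inclusion of `F_n ⋊ B` into `F_n ⋊ B_n`. -/
def semiIncl (n : ℕ) (B : Subgroup (BraidGroup n)) :
    FreeSemidirect n B →* FreeGroup (Fin n) ⋊[artin n] BraidGroup n :=
  SemidirectProduct.map (MonoidHom.id _) B.subtype (fun _ => rfl)

theorem semiToBraid_mem {n : ℕ} (g : FreeSemidirect n (pureBraid n)) :
    semiToBraid n (semiIncl n _ g) ∈ pureBraid (n + 1) := by
  refine MonoidHom.mem_ker.2 (Equiv.ext fun p => ?_)
  refine Fin.cases ?_ (fun p => ?_) p
  · have h := cosetAct_fst (semiToBraid n (semiIncl n _ g)) (0, 1) (Nat.succ_pos n)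
    rw [cosetAct_semiToBraid] at h
    exact Fin.ext h.symm
  · rw [braidPerm_semiToBraid]
    have : braidPerm n (semiIncl n _ g).right = 1 := g.right.2
    rw [this]; rfl

/-- The identification `P_{n+1} ≅ F_n ⋊ P_n`. Strand `0` of `P_{n+1}` moves around the others:
`σ_{0j}` corresponds to the free generator `x_j`, and `σ_{ij}` with `i > 0` to the `σ_{ij}` of
`P_n`; see `pureBraidEquiv_zero` and `pureBraidEquiv_pos`. -/
def pureBraidEquiv (n : ℕ) : pureBraid (n + 1) ≃* FreeSemidirect n (pureBraid n) where
  toFun b := ⟨(kappa n b).left, ⟨(kappa n b).right, kappa_right_mem b.2⟩⟩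
  invFun g := ⟨semiToBraid n (semiIncl n _ g), semiToBraid_mem g⟩
  left_inv b := Subtype.ext (semiToBraid_kappa b.1 (cosetAct_pure b.2))
  right_inv g := by
    have h : kappa n (semiToBraid n (semiIncl n _ g)) = semiIncl n _ g := by
      rw [kappa, cosetAct_semiToBraid]
    refine SemidirectProduct.ext ?_ (Subtype.ext ?_)
    · exact (congrArg SemidirectProduct.left h :)
    · exact (congrArg SemidirectProduct.right h :)
  map_mul' a b := by
    have h := kappa_mul a.1 b.1 (cosetAct_pure b.2)
    refine SemidirectProduct.ext ?_ (Subtype.ext ?_)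
    · exact (congrArg SemidirectProduct.left h :)
    · exact (congrArg SemidirectProduct.right h :)

/-- `σ_{0j} ↦ x_j` for `1 ≤ j ≤ n`; here `j` is written `j + 1` with `j : Fin n`. -/
theorem pureBraidEquiv_zero (n : ℕ) (j : Fin n) :
    pureBraidEquiv n (sigmaPure (n + 1) 0 (j.1 + 1)) = SemidirectProduct.inl (.of j) := by
  rw [← MulEquiv.eq_symm_apply]
  refine Subtype.ext ?_
  rw [← loop_eq, ← freeToBraid_of]
  exact (SemidirectProduct.lift_inl ..).symm

/-- `σ_{ij} ↦ σ_{ij}` for `1 ≤ i < j ≤ n`; the strands `1, …, n` are numbered `0, …, n - 1` in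
`B_n`. -/
theorem pureBraidEquiv_pos (n i j : ℕ) (hij : i < j) (hj : j < n) :
    pureBraidEquiv n (sigmaPure (n + 1) (i + 1) (j + 1))
      = SemidirectProduct.inr (sigmaPure n i j) := by
  rw [← MulEquiv.eq_symm_apply]
  refine Subtype.ext ?_
  have h1 : ((pureBraidEquiv n).symm (SemidirectProduct.inr (sigmaPure n i j)) :
      BraidGroup (n + 1)) = shift n (sigmaPure n i j) := SemidirectProduct.lift_inr ..
  have h2 : shift n ((List.range' i (j - 1 - i)).map fun k => (sigma n k)⁻¹).prod
      = ((List.range' (i + 1) (j - 1 - i)).map fun k => (sigma (n + 1) k)⁻¹).prod := by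
    rw [map_list_prod, List.map_map, add_comm i 1, ← List.map_add_range', List.map_map]
    congr 1
    refine List.map_congr_left fun k hk => ?_
    have := (List.mem_range'_1.1 hk).2
    simp only [Function.comp_apply, map_inv]
    rw [shift_sigma (by omega), add_comm 1 k]
  rw [h1, coe_sigmaPure, coe_sigmaPure, map_mul, map_mul, map_inv, map_pow, h2,
    shift_sigma (by omega), Nat.sub_add_cancel (by omega), Nat.add_sub_cancel,
    show j - (i + 1) = j - 1 - i by omega]

/-! ### The twisted Long–Moody construction

Throughout, `A` is a `k`-algebra (in the application `A = End_k(V)`), and an endomorphism of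
`V^{⊕ n}` is an `n × n` block matrix with entries in `A`. -/

/-- The affine bijection `m ↦ m a + v` of `A^n`. -/
def affinePerm {A : Type*} [Ring A] {n : ℕ} (a : Aˣ) (v : Fin n → A) :
    Equiv.Perm (Fin n → A) where
  toFun m := fun k => m k * a + v k
  invFun m := fun k => (m k - v k) * (a⁻¹ : Aˣ)
  left_inv m := by ext; simp
  right_inv m := by ext; simp

/-- For `g : F_n → Aˣ`, the Fox derivative `D : F_n → A^n`, that is, the map with
`D(u v) = D(u) g(v) + D(v)` and `D(x_j)` the `j`-th unit vector: the coefficients, evaluated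
by `g`, in `u - 1 = ∑_k (x_k - 1) D(u)_k`. It is the translation part of the (right) action of
`F_n` on `A^n` in which `x_j` acts by `m ↦ m g(x_j) + e_j`. -/
def fox {A : Type*} [Ring A] {n : ℕ} (g : FreeGroup (Fin n) →* Aˣ) (u : FreeGroup (Fin n)) :
    Fin n → A :=
  (FreeGroup.lift (fun j : Fin n =>
    MulOpposite.op (affinePerm (g (.of j)) (Pi.single j 1))) u).unop 0

theorem fox_aux {A : Type*} [Ring A] {n : ℕ} (g : FreeGroup (Fin n) →* Aˣ)
    (u : FreeGroup (Fin n)) (m : Fin n → A) :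
    (FreeGroup.lift (fun j : Fin n =>
      MulOpposite.op (affinePerm (g (.of j)) (Pi.single j 1))) u).unop m
      = fun k => m k * g u + fox g u k := by
  unfold fox
  set f := FreeGroup.lift (fun j : Fin n =>
      MulOpposite.op (affinePerm (g (.of j)) (Pi.single j (1 : A)))) with hf
  induction u generalizing m with
  | C1 => ext; simp
  | of j => ext; simp [hf, affinePerm]
  | inv_of j _ => ext; simp [hf, affinePerm, Equiv.Perm.inv_def, sub_eq_add_neg, add_mul]
  | mul u v hu hv =>
    ext k
    simp only [map_mul, MulOpposite.unop_mul, Equiv.Perm.mul_apply, Units.val_mul]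
    rw [hu m, hv, hv ((MulOpposite.unop (f u)) 0)]
    simp only [add_mul, mul_assoc, add_assoc]

theorem fox_of {A : Type*} [Ring A] {n : ℕ} (g : FreeGroup (Fin n) →* Aˣ) (j : Fin n) :
    fox g (.of j) = Pi.single j 1 := by
  ext k
  simp [fox, affinePerm]

theorem fox_mul {A : Type*} [Ring A] {n : ℕ} (g : FreeGroup (Fin n) →* Aˣ)
    (u v : FreeGroup (Fin n)) : fox g (u * v) = fun k => fox g u k * g v + fox g v k := by
  conv_lhs => unfold fox
  rw [map_mul, MulOpposite.unop_mul, Equiv.Perm.mul_apply, fox_aux]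
  rfl

theorem fox_one {A : Type*} [Ring A] {n : ℕ} (g : FreeGroup (Fin n) →* Aˣ) :
    fox g 1 = 0 := by
  simp [fox]

theorem fox_inv {A : Type*} [Ring A] {n : ℕ} (g : FreeGroup (Fin n) →* Aˣ)
    (u : FreeGroup (Fin n)) : fox g u⁻¹ = fun k => - (fox g u k * (g u)⁻¹) := by
  have h := fox_mul g u u⁻¹
  rw [mul_inv_cancel, fox_one] at h
  ext k
  have := congrFun h k
  rw [map_inv] at this
  exact (neg_eq_of_add_eq_zero_right this.symm).symm

/-- The Fox Jacobian of an automorphism `α` of `F_n`: its `j`-th column is `D(α(x_j))`. -/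
def foxMatrix {A : Type*} [Ring A] {n : ℕ} (g : FreeGroup (Fin n) →* Aˣ)
    (α : MulAut (FreeGroup (Fin n))) : Matrix (Fin n) (Fin n) A :=
  Matrix.of fun k j => fox g (α (.of j)) k

theorem foxMatrix_mulVec {A : Type*} [Ring A] {n : ℕ} (g : FreeGroup (Fin n) →* Aˣ)
    (α : MulAut (FreeGroup (Fin n))) (u : FreeGroup (Fin n)) :
    (foxMatrix g α).mulVec (fox (g.comp α.toMonoidHom) u) = fox g (α u) := by
  induction u with
  | C1 => simp [fox_one]
  | of j => rw [fox_of]; ext k; simp [foxMatrix]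
  | inv_of j h =>
    rw [fox_inv, map_inv, fox_inv, ← h]
    ext k
    simp [Matrix.mulVec, dotProduct, Finset.sum_mul, mul_assoc]
  | mul u v hu hv =>
    rw [fox_mul, map_mul, fox_mul, ← hu, ← hv]
    ext k
    simp [Matrix.mulVec, dotProduct, Finset.sum_mul, mul_assoc, mul_add, Finset.sum_add_distrib]

theorem foxMatrix_mul {A : Type*} [Ring A] {n : ℕ} (g : FreeGroup (Fin n) →* Aˣ)
    (α β : MulAut (FreeGroup (Fin n))) :
    foxMatrix g (α * β) = foxMatrix g α * foxMatrix (g.comp α.toMonoidHom) β := by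
  ext k j
  exact (congrFun (foxMatrix_mulVec g α (β (.of j))) k).symm

theorem foxMatrix_one {A : Type*} [Ring A] {n : ℕ} (g : FreeGroup (Fin n) →* Aˣ) :
    foxMatrix g 1 = 1 := by
  ext k j
  simp [foxMatrix, fox_of, Pi.single_apply, Matrix.one_apply]

/-- The image of `x_i` under the Dettweiler–Reiter convolution, for `g_c = g(x_c)`: the identity
matrix with its `i`-th row replaced by
`(λ(g_1 - 1), …, λ(g_{i-1} - 1), λ g_i, g_{i+1} - 1, …, g_n - 1)`. -/
def drMatrix {k A : Type*} [CommRing k] [Ring A] [Algebra k A] {n : ℕ} (lam : kˣ)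
    (g : FreeGroup (Fin n) →* Aˣ) (i : Fin n) : Matrix (Fin n) (Fin n) A :=
  Matrix.of fun r c =>
    if r = i then
      if c < i then (lam : k) • ((g (.of c) : A) - 1)
      else if c = i then (lam : k) • (g (.of c) : A)
      else (g (.of c) : A) - 1
    else if r = c then 1 else 0

/-- The inverse of `drMatrix`. -/
def drMatrixInv {k A : Type*} [CommRing k] [Ring A] [Algebra k A] {n : ℕ} (lam : kˣ)
    (g : FreeGroup (Fin n) →* Aˣ) (i : Fin n) : Matrix (Fin n) (Fin n) A :=
  Matrix.of fun r c =>
    if r = i then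
      ((lam⁻¹ : kˣ) : k) • (((g (.of i))⁻¹ : Aˣ) : A) *
        (if c < i then - ((lam : k) • ((g (.of c) : A) - 1))
          else if c = i then 1
          else - ((g (.of c) : A) - 1))
    else if r = c then 1 else 0

theorem row_mul {A : Type*} [Ring A] {n : ℕ} (i : Fin n) (x y : Fin n → A) :
    (Matrix.of fun r c => if r = i then x c else if r = c then 1 else 0) *
      (Matrix.of fun r c => if r = i then y c else if r = c then (1 : A) else 0)
    = Matrix.of fun r c => if r = i then x i * y c + (if c = i then 0 else x c)
        else if r = c then 1 else 0 := by
  ext r c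
  simp only [Matrix.mul_apply, Matrix.of_apply]
  by_cases hr : r = i
  · simp only [hr, if_true]
    rw [← Finset.add_sum_erase _ _ (Finset.mem_univ i)]
    simp only [if_true]
    congr 1
    rw [Finset.sum_congr rfl (g := fun d => if d = c then x d else 0)]
    · by_cases hc : c = i
      · subst hc
        simp only [if_true]
        exact Finset.sum_eq_zero fun d hd => if_neg (Finset.ne_of_mem_erase hd)
      · rw [if_neg hc, Finset.sum_ite_eq_of_mem' _ _ _ (by simp [hc])]
    · intro d hd
      rw [if_neg (Finset.ne_of_mem_erase hd)]; simp
  · simp only [hr, if_false]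
    rw [Finset.sum_eq_single r]
    · simp [hr]
    · intro d _ hd
      rw [if_neg hd.symm, zero_mul]
    · simp

/-- `drMatrix` as an invertible matrix. -/
def drUnit {k A : Type*} [CommRing k] [Ring A] [Algebra k A] {n : ℕ} (lam : kˣ)
    (g : FreeGroup (Fin n) →* Aˣ) (i : Fin n) : (Matrix (Fin n) (Fin n) A)ˣ where
  val := drMatrix lam g i
  inv := drMatrixInv lam g i
  val_inv := by
    rw [drMatrix, drMatrixInv, row_mul]
    ext r c
    simp only [Matrix.of_apply, Matrix.one_apply]
    by_cases hr : r = i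
    · subst hr
      simp only [if_true, lt_irrefl, if_false]
      rcases lt_trichotomy c r with h | h | h
      · simp [h, h.ne, h.ne', smul_smul]
      · simp [h, smul_smul]
      · simp [h.ne', h.ne, not_lt.2 h.le, smul_smul]
    · simp [hr]
  inv_val := by
    rw [drMatrix, drMatrixInv, row_mul]
    ext r c
    simp only [Matrix.of_apply, Matrix.one_apply]
    by_cases hr : r = i
    · subst hr
      simp only [if_true, lt_irrefl, if_false]
      rcases lt_trichotomy c r with h | h | h
      · simp [h, h.ne, h.ne', smul_smul]
      · simp [h, smul_smul]
      · simp [h.ne', h.ne, not_lt.2 h.le, ← smul_add, ← mul_add]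
    · simp [hr]

/-- The Dettweiler–Reiter convolution of a representation of `F_n`. -/
def drHom {k A : Type*} [CommRing k] [Ring A] [Algebra k A] {n : ℕ} (lam : kˣ)
    (g : FreeGroup (Fin n) →* Aˣ) : FreeGroup (Fin n) →* (Matrix (Fin n) (Fin n) A)ˣ :=
  FreeGroup.lift (drUnit lam g)

theorem drHom_of {k A : Type*} [CommRing k] [Ring A] [Algebra k A] {n : ℕ} (lam : kˣ)
    (g : FreeGroup (Fin n) →* Aˣ) (i : Fin n) :
    (drHom lam g (.of i) : Matrix (Fin n) (Fin n) A) = drMatrix lam g i := by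
  rw [drHom, FreeGroup.lift_apply_of]; rfl

/-- The non-trivial row of `drMatrix - 1`. -/
def drRow {k A : Type*} [CommRing k] [Ring A] [Algebra k A] {n : ℕ} (lam : kˣ)
    (g : FreeGroup (Fin n) →* Aˣ) (i : Fin n) : Fin n → A := fun c =>
  if c < i then (lam : k) • ((g (.of c) : A) - 1)
  else if c = i then (lam : k) • (g (.of c) : A) - 1
  else (g (.of c) : A) - 1

theorem drMatrix_eq {k A : Type*} [CommRing k] [Ring A] [Algebra k A] {n : ℕ} (lam : kˣ)
    (g : FreeGroup (Fin n) →* Aˣ) (i : Fin n) :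
    drMatrix lam g i = 1 + Matrix.vecMulVec (Pi.single i 1) (drRow lam g i) := by
  ext r c
  simp only [drMatrix, drRow, Matrix.of_apply, Matrix.add_apply, Matrix.one_apply,
    Matrix.vecMulVec_apply, Pi.single_apply]
  by_cases hr : r = i
  · subst hr
    simp only [if_true, one_mul]
    rcases lt_trichotomy c r with h | h | h
    · simp [h, h.ne']
    · simp [h]
    · simp [h.ne', h.ne, not_lt.2 h.le]
  · simp [hr]

theorem artin_foxMatrix_vecMul {A : Type*} [Ring A] {n i : ℕ} (hi : i + 1 < n)
    (g : FreeGroup (Fin n) →* Aˣ) (v : Fin n → A) (c : Fin n) :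
    Matrix.vecMul v (foxMatrix g (artinGen n i)) c =
      if c.1 = i then v ⟨i + 1, hi⟩
      else if c.1 = i + 1 then v ⟨i, by omega⟩ * g (.of ⟨i + 1, hi⟩) + v ⟨i + 1, hi⟩ *
        (1 - (g (artinGen n i (.of ⟨i + 1, hi⟩)) : Aˣ))
      else v c := by
  simp only [Matrix.vecMul, dotProduct, foxMatrix, Matrix.of_apply]
  by_cases h1 : c.1 = i
  · rw [artinGen_of hi, if_pos h1, if_pos h1, fox_of]
    simp [Pi.single_apply]
  by_cases h2 : c.1 = i + 1
  · rw [artinGen_of hi, artinGen_of hi, if_neg h1, if_neg h1, if_pos h2, if_pos h2,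
      if_neg (by simp), if_pos rfl, fox_mul, fox_mul, fox_inv, fox_of, fox_of]
    simp only [mul_add, Finset.sum_add_distrib, add_mul, Pi.single_apply]
    simp [mul_assoc, mul_sub]
    abel
  · rw [artinGen_of hi, if_neg h1, if_neg h1, if_neg h2, if_neg h2, fox_of]
    simp [Pi.single_apply]

theorem artin_drRow {k A : Type*} [CommRing k] [Ring A] [Algebra k A] {n i : ℕ} (lam : kˣ)
    (hi : i + 1 < n) (g : FreeGroup (Fin n) →* Aˣ) (j : Fin n) (h1 : j.1 ≠ i) (h2 : j.1 ≠ i + 1) :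
    Matrix.vecMul (drRow lam g j) (foxMatrix g (artinGen n i)) =
      drRow lam (g.comp (artinGen n i).toMonoidHom) j := by
  ext c
  rw [artin_foxMatrix_vecMul hi]
  simp only [drRow, MonoidHom.comp_apply, MulEquiv.coe_toMonoidHom]
  rw [artinGen_of hi c, artinGen_of hi ⟨i + 1, hi⟩]
  obtain ⟨j, hj⟩ := j
  obtain ⟨c, hc⟩ := c
  simp only [Fin.lt_def, Fin.ext_iff] at *
  by_cases c1 : c = i
  · subst c1
    by_cases h : c < j
    · simp [h, show c + 1 < j by omega]
    · simp [h, show ¬ c + 1 < j by omega, h1.symm, h2.symm]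
  by_cases c2 : c = i + 1
  · subst c2
    by_cases h : i < j
    · simp [h, show i + 1 < j by omega]
      rw [← smul_add]
      congr 1
      simp [sub_mul, mul_sub, mul_assoc]
      abel
    · simp [h, show ¬ i + 1 < j by omega, h1.symm, h2.symm]
      simp [sub_mul, mul_sub, mul_assoc]
      abel
  simp [c1, c2]

theorem artin_drRow_self {k A : Type*} [CommRing k] [Ring A] [Algebra k A] {n i : ℕ} (lam : kˣ)
    (hi : i + 1 < n) (g : FreeGroup (Fin n) →* Aˣ) :
    Matrix.vecMul (drRow lam g ⟨i + 1, hi⟩) (foxMatrix g (artinGen n i)) =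
      drRow lam (g.comp (artinGen n i).toMonoidHom) ⟨i, by omega⟩ := by
  ext c
  rw [artin_foxMatrix_vecMul hi]
  simp only [drRow, MonoidHom.comp_apply, MulEquiv.coe_toMonoidHom]
  rw [artinGen_of hi c, artinGen_of hi ⟨i + 1, hi⟩]
  obtain ⟨c, hc⟩ := c
  simp only [Fin.lt_def, Fin.ext_iff] at *
  by_cases c1 : c = i
  · subst c1
    simp
  by_cases c2 : c = i + 1
  · subst c2
    simp [sub_mul, mul_sub, mul_assoc, smul_sub]
    abel
  by_cases h : c < i
  · simp [c1, c2, h, show c < i + 1 by omega]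
  · simp [c1, c2, h, show ¬ c < i + 1 by omega]

theorem artin_drRow_succ {k A : Type*} [CommRing k] [Ring A] [Algebra k A] {n i : ℕ} (lam : kˣ)
    (hi : i + 1 < n) (g : FreeGroup (Fin n) →* Aˣ) :
    Matrix.vecMul (drRow lam g ⟨i, by omega⟩) (foxMatrix g (artinGen n i)) +
      ((g (.of ⟨i + 1, hi⟩) : A) - 1) •
        drRow lam (g.comp (artinGen n i).toMonoidHom) ⟨i, by omega⟩ =
      (g (.of ⟨i + 1, hi⟩) : A) •
        drRow lam (g.comp (artinGen n i).toMonoidHom) ⟨i + 1, hi⟩ := by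
  ext c
  simp only [Pi.add_apply, Pi.smul_apply, smul_eq_mul]
  rw [artin_foxMatrix_vecMul hi]
  simp only [drRow, MonoidHom.comp_apply, MulEquiv.coe_toMonoidHom]
  rw [artinGen_of hi c, artinGen_of hi ⟨i + 1, hi⟩]
  obtain ⟨c, hc⟩ := c
  simp only [Fin.lt_def, Fin.ext_iff] at *
  by_cases c1 : c = i
  · subst c1
    simp [sub_mul, mul_sub, smul_sub]
  by_cases c2 : c = i + 1
  · subst c2
    simp [sub_mul, mul_sub, mul_assoc]
    abel
  by_cases h : c < i
  · simp [c1, c2, h, show c < i + 1 by omega]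
    rw [← smul_add]; congr 1; noncomm_ring
  · simp [c1, c2, h, show ¬ c < i + 1 by omega]
    noncomm_ring

theorem foxMatrix_artinGen_single {A : Type*} [Ring A] {n i : ℕ}
    (g : FreeGroup (Fin n) →* Aˣ) (j : Fin n) :
    (foxMatrix g (artinGen n i)).mulVec (Pi.single j 1) = fox g (artinGen n i (.of j)) := by
  ext r
  simp [foxMatrix]

/-- The Dettweiler–Reiter convolution is compatible with the Artin action. -/
theorem foxMatrix_mul_drHom {k A : Type*} [CommRing k] [Ring A] [Algebra k A] {n : ℕ} (lam : kˣ)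
    (b : BraidGroup n) (g : FreeGroup (Fin n) →* Aˣ) (w : FreeGroup (Fin n)) :
    foxMatrix g (artin n b) *
        (drHom lam (g.comp (artin n b).toMonoidHom) w : Matrix (Fin n) (Fin n) A)
      = drHom lam g (artin n b w) * foxMatrix g (artin n b) := by
  let H : Subgroup (BraidGroup n) :=
    { carrier := {b | ∀ (g : FreeGroup (Fin n) →* Aˣ) (w : FreeGroup (Fin n)),
        foxMatrix g (artin n b) *
          (drHom lam (g.comp (artin n b).toMonoidHom) w : Matrix (Fin n) (Fin n) A)
        = drHom lam g (artin n b w) * foxMatrix g (artin n b)}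
      one_mem' := by
        intro g w
        rw [map_one, foxMatrix_one, one_mul, mul_one]
        rfl
      mul_mem' := by
        intro a b ha hb g w
        rw [map_mul, foxMatrix_mul, mul_assoc]
        have h1 := hb (g.comp (artin n a).toMonoidHom) w
        have h2 := ha g (artin n b w)
        have e : g.comp (artin n a * artin n b).toMonoidHom
            = (g.comp (artin n a).toMonoidHom).comp (artin n b).toMonoidHom := rfl
        rw [e, h1, ← mul_assoc, h2, mul_assoc]
        rfl
      inv_mem' := by
        intro a ha g w
        have h1 := ha (g.comp (artin n a⁻¹).toMonoidHom) (artin n a⁻¹ w)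
        have e : (g.comp (artin n a⁻¹).toMonoidHom).comp (artin n a).toMonoidHom = g := by
          ext1 j
          change g ((artin n a⁻¹ * artin n a) _) = _
          rw [← map_mul, inv_mul_cancel, map_one]; rfl
        have e2 : artin n a (artin n a⁻¹ w) = w := by
          rw [← MulAut.mul_apply, ← map_mul, mul_inv_cancel, map_one]; rfl
        have f1 := foxMatrix_mul g (artin n a⁻¹) (artin n a)
        have f2 := foxMatrix_mul (g.comp (artin n a⁻¹).toMonoidHom) (artin n a) (artin n a⁻¹)
        rw [e] at f2
        rw [← map_mul, inv_mul_cancel, map_one, foxMatrix_one] at f1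
        rw [← map_mul, mul_inv_cancel, map_one, foxMatrix_one] at f2
        rw [e, e2] at h1
        set J := foxMatrix g (artin n a⁻¹)
        set K := foxMatrix (g.comp (artin n a⁻¹).toMonoidHom) (artin n a)
        calc J * (drHom lam (g.comp (artin n a⁻¹).toMonoidHom) w : Matrix (Fin n) (Fin n) A)
            = J * (drHom lam (g.comp (artin n a⁻¹).toMonoidHom) w * K) * J := by
              rw [mul_assoc, mul_assoc, ← f2, mul_one]
          _ = (J * K) * drHom lam g (artin n a⁻¹ w) * J := by rw [← h1]; noncomm_ring
          _ = _ := by rw [← f1, one_mul] }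
  refine braid_mem H (fun i hi => ?_) b g w
  intro g w
  rw [artin_sigma hi]
  set J := foxMatrix g (artinGen n i) with hJ
  set g' := g.comp (artinGen n i).toMonoidHom with hg'
  have hgen : ∀ j : Fin n, J * (drHom lam g' (.of j) : Matrix (Fin n) (Fin n) A)
      = drHom lam g (artinGen n i (.of j)) * J := by
    intro j
    rw [drHom_of, drMatrix_eq, mul_add, mul_one, Matrix.mul_vecMulVec, hJ,
      foxMatrix_artinGen_single, ← hJ]
    have e : drMatrix lam g ⟨i + 1, hi⟩ * J
        = J + Matrix.vecMulVec (Pi.single ⟨i + 1, hi⟩ 1) (drRow lam g' ⟨i, by omega⟩) := by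
      rw [drMatrix_eq, add_mul, one_mul, Matrix.vecMulVec_mul, artin_drRow_self lam hi]
    by_cases h1 : j.1 = i
    · have hj : j = ⟨i, by omega⟩ := Fin.ext h1
      rw [artinGen_of hi, if_pos h1, drHom_of, drMatrix_eq, add_mul, one_mul,
        Matrix.vecMulVec_mul, artin_drRow_self lam hi, fox_of, hj]
    by_cases h2 : j.1 = i + 1
    · obtain rfl : j = ⟨i + 1, hi⟩ := Fin.ext h2
      have hα : FreeGroup.of ⟨i + 1, hi⟩ * artinGen n i (.of ⟨i + 1, hi⟩)
          = .of ⟨i, by omega⟩ * .of ⟨i + 1, hi⟩ := by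
        rw [artinGen_of hi]; simp [mul_assoc]
      have hcol : (drMatrix lam g ⟨i + 1, hi⟩).mulVec (fox g (artinGen n i (.of ⟨i + 1, hi⟩)))
          = Pi.single (⟨i, by omega⟩ : Fin n) (g (.of ⟨i + 1, hi⟩) : A) := by
        rw [drMatrix_eq, Matrix.add_mulVec, Matrix.one_mulVec, Matrix.vecMulVec_mulVec]
        have hd : dotProduct (drRow lam g ⟨i + 1, hi⟩) (fox g (artinGen n i (.of ⟨i + 1, hi⟩)))
            = drRow lam g' ⟨i, by omega⟩ ⟨i + 1, hi⟩ :=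
          congrFun (artin_drRow_self lam hi g) ⟨i + 1, hi⟩
        rw [hd]
        ext r
        simp only [drRow, hg', MonoidHom.comp_apply, MulEquiv.coe_toMonoidHom]
        rw [artinGen_of hi, if_neg (by simp), if_pos rfl, fox_mul, fox_mul, fox_inv, fox_of,
          fox_of]
        obtain ⟨r, hr⟩ := r
        by_cases r1 : r = i
        · subst r1
          simp [Pi.single_apply]
        by_cases r2 : r = i + 1
        · subst r2
          simp [Pi.single_apply, mul_assoc]
        simp [Pi.single_apply, r1, r2]
      have hmain : drMatrix lam g ⟨i + 1, hi⟩ *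
            (J + Matrix.vecMulVec (fox g (artinGen n i (.of ⟨i + 1, hi⟩)))
              (drRow lam g' ⟨i + 1, hi⟩))
          = drMatrix lam g ⟨i, by omega⟩ * (drMatrix lam g ⟨i + 1, hi⟩ * J) := by
        rw [mul_add, Matrix.mul_vecMulVec, hcol, e, drMatrix_eq lam g ⟨i, _⟩, add_mul, one_mul,
          Matrix.vecMulVec_mul, Matrix.vecMul_add, Matrix.vecMul_vecMulVec]
        congr 1
        have e2 := artin_drRow_succ lam hi g
        have e3 : dotProduct (drRow lam g ⟨i, by omega⟩) (Pi.single ⟨i + 1, hi⟩ 1)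
            = (g (.of ⟨i + 1, hi⟩) : A) - 1 := by
          simp [drRow]
        rw [e3, e2]
        ext r c
        simp [Matrix.vecMulVec_apply, Pi.single_apply, hg']
      have h3 : (drHom lam g (artinGen n i (.of ⟨i + 1, hi⟩)) : Matrix (Fin n) (Fin n) A)
          = (drHom lam g (.of ⟨i + 1, hi⟩))⁻¹.val *
            (drMatrix lam g ⟨i, by omega⟩ * drMatrix lam g ⟨i + 1, hi⟩) := by
        rw [← drHom_of, ← drHom_of, ← Units.val_mul, ← Units.val_mul, ← map_mul, ← hα, map_mul,
          inv_mul_cancel_left]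
      rw [h3, mul_assoc, mul_assoc, ← hmain, ← drHom_of, Units.inv_mul_cancel_left]
    · rw [artinGen_of hi, if_neg h1, if_neg h2, drHom_of, drMatrix_eq, add_mul, one_mul,
        Matrix.vecMulVec_mul, artin_drRow lam hi g j h1 h2, fox_of]
  induction w with
  | C1 => simp
  | of j => exact hgen j
  | inv_of j h =>
    rw [map_inv, map_inv, map_inv, Units.mul_inv_eq_iff_eq_mul, mul_assoc, h,
      Units.inv_mul_cancel_left]
  | mul u v hu hv =>
    rw [map_mul, map_mul, map_mul, Units.val_mul, Units.val_mul, ← mul_assoc, hu, mul_assoc, hv,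
      mul_assoc]

theorem fox_conj {A : Type*} [Ring A] {n : ℕ} {g g' : FreeGroup (Fin n) →* Aˣ} {s : A}
    (h : ∀ u, s * (g u : A) = g' u * s) (u : FreeGroup (Fin n)) (c : Fin n) :
    s * fox g u c = fox g' u c * s := by
  induction u with
  | C1 => simp [fox_one]
  | of j => rw [fox_of, fox_of]; by_cases h : c = j <;> simp [h]
  | inv_of j hj =>
    have h' := h (.of j)⁻¹
    rw [map_inv, map_inv] at h'
    rw [fox_inv, fox_inv]
    simp only [mul_neg, neg_mul, ← mul_assoc]
    rw [hj, mul_assoc, h', mul_assoc]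
  | mul u v hu hv =>
    rw [fox_mul, fox_mul]
    simp only [mul_add, add_mul, ← mul_assoc]
    rw [hu, hv, mul_assoc, h, mul_assoc]

theorem drMatrix_conj {k A : Type*} [CommRing k] [Ring A] [Algebra k A] {n : ℕ} (lam : kˣ)
    {g g' : FreeGroup (Fin n) →* Aˣ} {s : A}
    (h : ∀ u, s * (g u : A) = g' u * s) (w : FreeGroup (Fin n)) :
    Matrix.diagonal (fun _ => s) * (drHom lam g w : Matrix (Fin n) (Fin n) A)
      = (drHom lam g' w : Matrix (Fin n) (Fin n) A) * Matrix.diagonal (fun _ => s) := by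
  induction w with
  | C1 => simp
  | of j =>
    rw [drHom_of, drHom_of]
    ext r c
    simp only [Matrix.diagonal_mul, Matrix.mul_diagonal, drMatrix, Matrix.of_apply]
    split_ifs <;> simp [mul_sub, sub_mul, h]
  | inv_of j hj =>
    rw [map_inv, map_inv, Units.mul_inv_eq_iff_eq_mul, mul_assoc, hj, Units.inv_mul_cancel_left]
  | mul u v hu hv =>
    rw [map_mul, map_mul, Units.val_mul, Units.val_mul, ← mul_assoc, hu, mul_assoc, hv, mul_assoc]

/-- The Long–Moody matrix of `b ∈ B`: the Fox Jacobian of `θ_b` times `ρ(b)^{⊕ n}`. Identifying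
`V^{⊕ n}` with `I ⊗_{k[F_n]} V` by `w ↦ ∑_j (x_j - 1) ⊗ w_j`, where `I` is the augmentation
ideal, this is the diagonal action of `b`. See `lmMatrix_sigma` for `b = σ_i`. -/
def lmMatrix {A : Type*} [Ring A] {n : ℕ} {B : Subgroup (BraidGroup n)}
    (rho : FreeSemidirect n B →* Aˣ) (b : B) : Matrix (Fin n) (Fin n) A :=
  foxMatrix (rho.comp SemidirectProduct.inl) (artin n b) *
    Matrix.diagonal (fun _ => (rho (SemidirectProduct.inr b) : A))

theorem rho_conj {A : Type*} [Ring A] {n : ℕ} {B : Subgroup (BraidGroup n)}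
    (rho : FreeSemidirect n B →* Aˣ) (b : B) (u : FreeGroup (Fin n)) :
    (rho (SemidirectProduct.inr b) : A) * (rho.comp SemidirectProduct.inl u : Aˣ)
      = ((rho.comp SemidirectProduct.inl).comp (artin n b).toMonoidHom u : Aˣ) *
        rho (SemidirectProduct.inr b) := by
  have h := SemidirectProduct.inl_aut (φ := (artin n).comp B.subtype) b u
  simp only [MonoidHom.comp_apply, ← Units.val_mul, ← map_mul]
  congr 2
  rw [map_inv, eq_mul_inv_iff_mul_eq] at h
  exact h.symm

/-- The Long–Moody construction `B → GL(V^{⊕ n})`. -/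
def lmHom {A : Type*} [Ring A] {n : ℕ} {B : Subgroup (BraidGroup n)}
    (rho : FreeSemidirect n B →* Aˣ) : B →* (Matrix (Fin n) (Fin n) A)ˣ :=
  MonoidHom.toHomUnits
    { toFun := lmMatrix rho
      map_one' := by simp [lmMatrix, foxMatrix_one]
      map_mul' := fun a b => by
        have h : Matrix.diagonal (fun _ => (rho (SemidirectProduct.inr a) : A)) *
              foxMatrix (rho.comp SemidirectProduct.inl) (artin n b)
            = foxMatrix ((rho.comp SemidirectProduct.inl).comp (artin n a).toMonoidHom)
              (artin n b) * Matrix.diagonal (fun _ => (rho (SemidirectProduct.inr a) : A)) := by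
          ext r c
          simp only [Matrix.diagonal_mul, Matrix.mul_diagonal, foxMatrix, Matrix.of_apply]
          exact fox_conj (rho_conj rho a) _ _
        simp only [lmMatrix]
        rw [Subgroup.coe_mul, map_mul, foxMatrix_mul, map_mul, map_mul, mul_assoc, mul_assoc,
          ← mul_assoc (Matrix.diagonal _), h, mul_assoc, Matrix.diagonal_mul_diagonal]
        simp }

/-- The twisted Long–Moody construction `ρ ↦ ρ^{LM}_λ` of representations of `F_n ⋊ B`, in block
matrices: the Dettweiler–Reiter convolution on `F_n` and the Long–Moody construction on `B`. -/
def twistedLM {k A : Type*} [CommRing k] [Ring A] [Algebra k A] {n : ℕ} (lam : kˣ)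
    {B : Subgroup (BraidGroup n)} (rho : FreeSemidirect n B →* Aˣ) :
    FreeSemidirect n B →* (Matrix (Fin n) (Fin n) A)ˣ :=
  SemidirectProduct.lift (drHom lam (rho.comp SemidirectProduct.inl)) (lmHom rho) (fun b => by
    ext1 j
    simp only [MonoidHom.comp_apply, MulEquiv.coe_toMonoidHom, MulAut.conj_apply]
    rw [eq_mul_inv_iff_mul_eq]
    refine Units.ext ?_
    change (drHom lam _ (artin n b _)).val * lmMatrix rho b = lmMatrix rho b * _
    rw [lmMatrix, mul_assoc, drMatrix_conj lam (rho_conj rho b), ← mul_assoc, ← mul_assoc,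
      foxMatrix_mul_drHom])

/-- On a generator `σ_i` that lies in `B`, the Long–Moody matrix is `s_i^{⊕ n}` times the block
diagonal matrix `diag(1, …, 1, R_i, 1, …, 1)` with `R_i = (0, g_i; 1, 1 - g_{i+1})` in rows and
columns `i`, `i + 1`. -/
theorem lmMatrix_sigma {A : Type*} [Ring A] {n i : ℕ} {B : Subgroup (BraidGroup n)}
    (rho : FreeSemidirect n B →* Aˣ) (hi : i + 1 < n) (hB : sigma n i ∈ B) :
    lmMatrix rho ⟨sigma n i, hB⟩ =
      Matrix.diagonal (fun _ => (rho (SemidirectProduct.inr ⟨sigma n i, hB⟩) : A)) *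
        Matrix.of fun r c : Fin n =>
          if r.1 = i ∧ c.1 = i then 0
          else if r.1 = i ∧ c.1 = i + 1 then
            (rho (SemidirectProduct.inl (.of ⟨i, by omega⟩)) : A)
          else if r.1 = i + 1 ∧ c.1 = i then 1
          else if r.1 = i + 1 ∧ c.1 = i + 1 then
            1 - (rho (SemidirectProduct.inl (.of ⟨i + 1, hi⟩)) : A)
          else if r = c then 1 else 0 := by
  set s : A := (rho (SemidirectProduct.inr ⟨sigma n i, hB⟩) : A) with hs
  have hc := rho_conj rho ⟨sigma n i, hB⟩
  rw [← hs] at hc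
  simp only [MonoidHom.comp_apply, MulEquiv.coe_toMonoidHom] at hc
  rw [artin_sigma hi] at hc
  have h1 := hc (.of ⟨i, by omega⟩)
  have h2 := hc (.of ⟨i + 1, hi⟩)
  rw [artinGen_of hi, if_pos rfl] at h1
  ext r c
  rw [lmMatrix, ← hs, Matrix.mul_diagonal, Matrix.diagonal_mul, artin_sigma hi, foxMatrix,
    Matrix.of_apply, Matrix.of_apply]
  obtain ⟨c, hcn⟩ := c
  obtain ⟨r, hrn⟩ := r
  rw [artinGen_of hi]
  by_cases c1 : c = i
  · subst c1
    rw [if_pos rfl, fox_of]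
    by_cases r1 : r = c
    · subst r1; simp
    by_cases r2 : r = c + 1
    · subst r2; simp
    simp [r1, r2]
  by_cases c2 : c = i + 1
  · subst c2
    rw [if_neg (by simp), if_pos rfl, fox_mul, fox_mul, fox_inv, fox_of, fox_of]
    by_cases r1 : r = i
    · subst r1
      simpa using h1.symm
    by_cases r2 : r = i + 1
    · subst r2
      rw [artinGen_of hi, if_neg (by simp), if_pos rfl] at h2
      simp [mul_add, h2, add_mul, mul_assoc, sub_eq_add_neg, add_comm]
    simp [r1, r2]
  rw [if_neg c1, if_neg c2, fox_of]
  by_cases hrc : r = c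
  · subst hrc; simp [c1, c2]
  · simp [c1, c2, hrc]

theorem twistedLM_inl {k A : Type*} [CommRing k] [Ring A] [Algebra k A] {n : ℕ} (lam : kˣ)
    {B : Subgroup (BraidGroup n)} (rho : FreeSemidirect n B →* Aˣ) (j : Fin n) :
    (twistedLM lam rho (SemidirectProduct.inl (.of j)) : Matrix (Fin n) (Fin n) A)
      = drMatrix lam (rho.comp SemidirectProduct.inl) j := by
  rw [twistedLM, SemidirectProduct.lift_inl, drHom_of]

theorem twistedLM_inr {k A : Type*} [CommRing k] [Ring A] [Algebra k A] {n : ℕ} (lam : kˣ)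
    {B : Subgroup (BraidGroup n)} (rho : FreeSemidirect n B →* Aˣ) (b : B) :
    (twistedLM lam rho (SemidirectProduct.inr b) : Matrix (Fin n) (Fin n) A)
      = lmMatrix rho b := by
  rw [twistedLM, SemidirectProduct.lift_inr]
  rfl

/-! ### Haraoka's convolution and the opposite representation -/

/-- An invertible block matrix with entries in `End_k(V)`, as an automorphism of `V^{⊕ n}`. -/
def blockGL (k V : Type*) [Field k] [AddCommGroup V] [Module k V] (n : ℕ) :
    (Matrix (Fin n) (Fin n) (Module.End k V))ˣ →* LinearMap.GeneralLinearGroup k (Fin n → V) :=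
  Units.map (endVecRingEquivMatrixEnd (Fin n) k V).symm.toMonoidHom

/-- The twisted Long–Moody construction for representations of `P_{n+1}`, identified with
`F_n ⋊ P_n`. -/
def pureLM {k V : Type*} [Field k] [AddCommGroup V] [Module k V] {n : ℕ} (lam : kˣ)
    (rho : pureBraid (n + 1) →* LinearMap.GeneralLinearGroup k V) :
    pureBraid (n + 1) →* LinearMap.GeneralLinearGroup k (Fin n → V) :=
  (blockGL k V n).comp
    ((twistedLM lam (rho.comp (pureBraidEquiv n).symm.toMonoidHom)).comp
      (pureBraidEquiv n).toMonoidHom)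

/-- For a homomorphism `ρ`, the anti-homomorphism `ρ^op = ρ ∘ inv`. An anti-homomorphism from
`G` to `H` is a homomorphism from `G` to `Hᵐᵒᵖ`. -/
def opHom {G H : Type*} [Group G] [Group H] (rho : G →* H) : G →* Hᵐᵒᵖ where
  toFun g := MulOpposite.op (rho g⁻¹)
  map_one' := by simp
  map_mul' a b := by simp

/-- Haraoka's matrix `N_{ij}`, for `0 ≤ i < j ≤ n`, as a function of `M_{ij}`. Rows and columns
are numbered `1, …, n`. -/
def haraokaMatrix {k A : Type*} [CommRing k] [Ring A] [Algebra k A] (lam : kˣ) (n : ℕ)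
    (M : ℕ → ℕ → Aˣ) (i j : ℕ) : Matrix (Fin n) (Fin n) A :=
  Matrix.of fun r c =>
    let a := r.1 + 1
    let b := c.1 + 1
    if i = 0 then
      if a = j then
        if b < j then (lam : k) • ((M 0 b : A) - 1)
        else if b = j then (lam : k) • (M 0 j : A)
        else (M 0 b : A) - 1
      else if a = b then 1 else 0
    else if a = i then
      if b = i then (M 0 j : A) * M i j
      else if i < b ∧ b < j then
        ((M 0 j : A) * M i j - ((M 0 i)⁻¹ : Aˣ) * M i j * M 0 i) * (1 - M 0 b)
      else if b = j then (M 0 j : A) * M i j * (1 - M 0 j)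
      else 0
    else if a = j then
      if b = i then (M i j : A) * (1 - M 0 i)
      else if i < b ∧ b < j then (M i j : A) * (1 - M 0 i) * (1 - M 0 b)
      else if b = j then (M i j : A) - M i j * M 0 j + M 0 j * M i j * M 0 i
      else 0
    else if a = b then
      if i < a ∧ a < j then (((M 0 i)⁻¹ : Aˣ) : A) * M i j * M 0 i else M i j
    else 0

/-- `T` is Haraoka's convolution with parameter `λ` of the anti-representation `η` of `P_{n+1}`:
it is an anti-representation of `P_{n+1}` on `V^{⊕ n}` with `T(σ̃_{ij}) = N_{ij}` for all
`0 ≤ i < j ≤ n`, where `N_{ij}` is formed from `M_{ij} = η(σ̃_{ij})`. -/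
def IsHaraokaConvolution {k V : Type*} [Field k] [AddCommGroup V] [Module k V] {n : ℕ} (lam : kˣ)
    (eta : pureBraid (n + 1) →* (LinearMap.GeneralLinearGroup k V)ᵐᵒᵖ)
    (T : pureBraid (n + 1) →* (LinearMap.GeneralLinearGroup k (Fin n → V))ᵐᵒᵖ) : Prop :=
  ∀ i j : ℕ, i < j → j ≤ n →
    ((T (sigmaTilde (n + 1) i j)).unop : Module.End k (Fin n → V)) =
      (endVecRingEquivMatrixEnd (Fin n) k V).symm
        (haraokaMatrix lam n (fun a b => (eta (sigmaTilde (n + 1) a b)).unop) i j)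

end HaraokaLong

open HaraokaLong

/-!
Since `ρ^op(σ̃_{ij}) = ρ(σ_{ij})`, and likewise for `ρ^{LM}_λ`, existence amounts to showing that the
twisted Long–Moody matrix of `σ_{ij}` is Haraoka's `N_{ij}`, formed from `M_{ij} = ρ(σ_{ij})`.

For `i = 0` both are the Dettweiler–Reiter matrix of `x_j` (`drMatrix_eq_haraokaMatrix`). For `i > 0`
one computes the action of `σ_{ij}` on the free group (`artin_sigmaPure_of`): with
`w = x_j⁻¹ x_i x_j` and `u = x_i⁻¹ w`, it sends `x_i` to `w`, `x_j` to `w⁻¹ x_j w`, and `x_k` to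
`u⁻¹ x_k u` for `i < k < j`. The Fox derivatives of these words, multiplied on the right by `M_{ij}`,
become the entries of `N_{ij}` once the relation `ρ(b) ρ(v) = ρ(θ_b(v)) ρ(b)` has been used to move
`M_{ij}` to the left (`lmMatrix_sigmaPure`).

Uniqueness holds because the `σ_{ij}` generate the pure braid group (`closure_sigmaPure`). This
follows by induction on the number of strands: under `P_{n+1} ≅ F_n ⋊ P_n` the `σ_{0j}` are the free
generators of `F_n`, and the other `σ_{ij}` are the generators of `P_n`.
-/

namespace HaraokaLong

/-! ### The Artin action of the pure braid generators -/

theorem artin_sigma_inv_of {n i : ℕ} (h : i + 1 < n) (j : Fin n) :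
    artin n (sigma n i)⁻¹ (.of j) = if j.1 = i then
      .of ⟨i, by omega⟩ * .of ⟨i + 1, h⟩ * (.of ⟨i, by omega⟩)⁻¹
    else if j.1 = i + 1 then .of ⟨i, by omega⟩
    else .of j := by
  rw [map_inv, artin_sigma h, MulAut.inv_apply, MulEquiv.symm_apply_eq]
  obtain ⟨j, hj⟩ := j
  dsimp only
  split_ifs with h1 h2
  · subst h1
    simp [artinGen_of h, mul_assoc]
  · subst h2
    simp [artinGen_of h]
  · simp [artinGen_of h, h1, h2]

/-- The conjugating braid `σ_i⁻¹ ⋯ σ_{i+m-1}⁻¹` carries `x_{i+m}` down to `x_i` and moves the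
generators that it passes one place up, conjugated by `x_i`. -/
theorem artin_prod_sigma_inv_of {n i m : ℕ} (h : i + m < n) (k : Fin n) :
    artin n ((List.range' i m).map fun l => (sigma n l)⁻¹).prod (.of k) =
      if hk : i ≤ k.1 ∧ k.1 < i + m then
        .of ⟨i, by omega⟩ * .of ⟨k.1 + 1, by omega⟩ * (.of ⟨i, by omega⟩)⁻¹
      else if k.1 = i + m then .of ⟨i, by omega⟩
      else .of k := by
  induction m generalizing k with
  | zero =>
    obtain ⟨k, hk⟩ := k
    by_cases h1 : k = i
    · subst h1; simp
    · simp [h1]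
  | succ m ih =>
    have ih := ih (by omega)
    rw [List.range'_concat, List.map_append, List.prod_append, map_mul, MulAut.mul_apply]
    simp only [List.map_cons, List.map_nil, List.prod_cons, List.prod_nil, mul_one, one_mul]
    rw [artin_sigma_inv_of (by omega)]
    obtain ⟨k, hk⟩ := k
    dsimp only
    by_cases h1 : k = i + m
    · subst h1
      simp [ih]
    by_cases h2 : k = i + m + 1
    · subst h2
      simp [ih, ← add_assoc]
    rw [if_neg h1, if_neg h2, ih]
    by_cases h3 : i ≤ k ∧ k < i + m
    · rw [dif_pos h3, dif_pos (by omega)]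
    · rw [dif_neg h3, if_neg h1, dif_neg (by omega), if_neg (by omega)]

/-- The action of `σ_i²` is conjugation by `x_i x_{i+1}` on the subgroup generated by `x_i` and
`x_{i+1}`. -/
theorem artin_sigma_sq_of {n i : ℕ} (h : i + 1 < n) (k : Fin n) :
    artin n (sigma n i ^ 2) (.of k) = if k.1 = i then
      (.of ⟨i + 1, h⟩)⁻¹ * .of ⟨i, by omega⟩ * .of ⟨i + 1, h⟩
    else if k.1 = i + 1 then
      ((.of ⟨i + 1, h⟩)⁻¹ * .of ⟨i, by omega⟩ * .of ⟨i + 1, h⟩)⁻¹ * .of ⟨i + 1, h⟩ *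
        ((.of ⟨i + 1, h⟩)⁻¹ * .of ⟨i, by omega⟩ * .of ⟨i + 1, h⟩)
    else .of k := by
  rw [pow_two, map_mul, MulAut.mul_apply, artin_sigma h, artinGen_of h]
  obtain ⟨k, hk⟩ := k
  dsimp only
  split_ifs with h1 h2
  · simp [artinGen_of h]
  · simp [artinGen_of h]
  · simp [artinGen_of h, h1, h2]

/-- The action of `σ_{ij}` on the free group. With `w = x_j⁻¹ x_i x_j` and `u = x_i⁻¹ w`, it sends
`x_i` to `w`, conjugates `x_j` by `w` and `x_k` by `u` for `i < k < j`, and fixes all other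
generators. -/
theorem artin_sigmaPure_of {n i j : ℕ} (hij : i < j) (hj : j < n) (k : Fin n)
    {x y w u : FreeGroup (Fin n)} (hx : x = .of ⟨i, by omega⟩) (hy : y = .of ⟨j, hj⟩)
    (hw : w = y⁻¹ * x * y) (hu : u = x⁻¹ * w) :
    artin n (sigmaPure n i j) (.of k) =
      if k.1 = i then w
      else if k.1 = j then w⁻¹ * y * w
      else if i < k.1 ∧ k.1 < j then u⁻¹ * .of k * u
      else .of k := by
  obtain ⟨m, rfl⟩ : ∃ m, j = i + m + 1 := ⟨j - i - 1, by omega⟩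
  rw [coe_sigmaPure, show i + m + 1 - 1 - i = m by omega, Nat.add_sub_cancel]
  set c := ((List.range' i m).map fun l => (sigma n l)⁻¹).prod with hc
  have hconj : ∀ v, artin n (c * sigma n (i + m) ^ 2 * c⁻¹) (artin n c v)
      = artin n c (artin n (sigma n (i + m) ^ 2) v) := fun v => by
    rw [← MulAut.mul_apply, ← map_mul, inv_mul_cancel_right, map_mul, MulAut.mul_apply]
  have hcof := artin_prod_sigma_inv_of (n := n) (i := i) (m := m) (by omega)
  rw [← hc] at hcof
  have hsq := artin_sigma_sq_of (n := n) (i := i + m) hj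
  generalize artin n (c * sigma n (i + m) ^ 2 * c⁻¹) = T at hconj ⊢
  generalize artin n c = C at hconj hcof
  generalize artin n (sigma n (i + m) ^ 2) = Q at hconj hsq
  have cx : C (.of ⟨i + m, by omega⟩) = x := by
    rw [hcof, dif_neg (by simp), if_pos rfl, hx]
  have cy : C (.of ⟨i + m + 1, hj⟩) = y := by
    rw [hcof, dif_neg (by simp), if_neg (by simp), hy]
  have hX : T x = w := by
    have := hconj (.of ⟨i + m, by omega⟩)
    rw [cx, hsq, if_pos rfl, map_mul, map_mul, map_inv, cx, cy] at this
    rw [this, hw]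
  obtain ⟨k, hk⟩ := k
  dsimp only
  split_ifs with h1 h2 h3
  · subst h1; rw [← hx, hX]
  · subst h2
    have := hconj (.of ⟨i + m + 1, hj⟩)
    rw [cy, hsq, if_neg (by simp), if_pos rfl] at this
    simp only [map_mul, map_inv, cx, cy] at this
    rw [← hy, this, hw]
  · obtain ⟨l, rfl⟩ : ∃ l, k = l + 1 := ⟨k - 1, by omega⟩
    have h := hconj (.of ⟨l, by omega⟩)
    rw [hsq, if_neg (by dsimp only; omega), if_neg (by dsimp only; omega), hcof,
      dif_pos (by dsimp only; omega), ← hx] at h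
    simp only [map_mul, map_inv, hX] at h
    rw [mul_inv_eq_iff_eq_mul, ← eq_inv_mul_iff_mul_eq] at h
    rw [h, hu]
    group
  · have h := hconj (.of ⟨k, hk⟩)
    rw [hsq, if_neg (by dsimp only; omega), if_neg (by dsimp only; omega), hcof,
      dif_neg (by dsimp only; omega), if_neg (by dsimp only; omega)] at h
    exact h

/-! ### Generation of the pure braid group -/

theorem braidGroup_eq_one_of_le_one {n : ℕ} (hn : n ≤ 1) (b : BraidGroup n) : b = 1 :=
  Subgroup.mem_bot.1 (braid_mem ⊥ (fun i hi => by omega) b)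

/-- The pure braid group is generated by the `σ_{ij}`, by induction along
`P_{n+1} ≅ F_n ⋊ P_n`. -/
theorem closure_sigmaPure (n : ℕ) :
    Subgroup.closure {g | ∃ i j, i < j ∧ j < n ∧ g = sigmaPure n i j} = ⊤ := by
  induction n with
  | zero =>
    refine eq_top_iff.2 fun g _ => ?_
    have hg : g = 1 := Subtype.ext (braidGroup_eq_one_of_le_one (Nat.zero_le 1) g.1)
    rw [hg]
    exact one_mem _
  | succ n ih =>
    set H := Subgroup.closure {g | ∃ i j, i < j ∧ j < n + 1 ∧ g = sigmaPure (n + 1) i j}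
    have hsub : ∀ i j, i < j → j < n + 1 → sigmaPure (n + 1) i j ∈ H := fun i j hi hj =>
      Subgroup.subset_closure ⟨i, j, hi, hj, rfl⟩
    let K := H.comap (pureBraidEquiv n).symm.toMonoidHom
    have hl : ∀ w : FreeGroup (Fin n), SemidirectProduct.inl w ∈ K := by
      intro w
      induction w with
      | C1 => rw [map_one]; exact K.one_mem
      | of j =>
        change (pureBraidEquiv n).symm _ ∈ H
        rw [← pureBraidEquiv_zero, MulEquiv.symm_apply_apply]
        exact hsub _ _ (by omega) (by omega)
      | inv_of j hj => rw [map_inv]; exact K.inv_mem hj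
      | mul a b ha hb => rw [map_mul]; exact K.mul_mem ha hb
    have hr : (⊤ : Subgroup (pureBraid n)) ≤ K.comap SemidirectProduct.inr := by
      rw [← ih, Subgroup.closure_le]
      rintro _ ⟨i, j, hij, hj, rfl⟩
      change (pureBraidEquiv n).symm _ ∈ H
      rw [← pureBraidEquiv_pos n i j hij hj, MulEquiv.symm_apply_apply]
      exact hsub _ _ (by omega) (by omega)
    refine eq_top_iff.2 fun g _ => ?_
    have hg : pureBraidEquiv n g ∈ K := by
      rw [← SemidirectProduct.inl_left_mul_inr_right (pureBraidEquiv n g)]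
      exact K.mul_mem (hl _) (hr (Subgroup.mem_top _))
    simpa [K] using hg

/-! ### The Long–Moody matrices of the pure braid generators -/

theorem fox_inv_mul_mul {A : Type*} [Ring A] {n : ℕ} (g : FreeGroup (Fin n) →* Aˣ)
    (u v : FreeGroup (Fin n)) (r : Fin n) :
    fox g (u⁻¹ * v * u) r = fox g u r * (1 - (g (u⁻¹ * v * u) : Aˣ)) + fox g v r * g u := by
  rw [fox_mul, fox_mul, fox_inv]
  simp only [map_mul, map_inv, Units.val_mul]
  noncomm_ring

/-- The Fox Jacobian of `θ(σ_{ij})`, multiplied by `ρ(σ_{ij})^{⊕ n}`, is Haraoka's matrix: the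
relation `ρ(b) ρ(v) = ρ(θ_b(v)) ρ(b)` moves `M_{ij}` into the positions where it occurs there. -/
theorem lmMatrix_sigmaPure {k A : Type*} [CommRing k] [Ring A] [Algebra k A] (lam : kˣ)
    {n i j : ℕ} (hij : i < j) (hj : j < n) (rho : FreeSemidirect n (pureBraid n) →* Aˣ)
    (M : ℕ → ℕ → Aˣ) (h0 : ∀ l : Fin n, M 0 (l.1 + 1) = rho (SemidirectProduct.inl (.of l)))
    (h1 : M (i + 1) (j + 1) = rho (SemidirectProduct.inr (sigmaPure n i j))) :
    lmMatrix rho (sigmaPure n i j) = haraokaMatrix lam n M (i + 1) (j + 1) := by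
  set g := rho.comp SemidirectProduct.inl with hg
  obtain ⟨x, hx⟩ : ∃ x : FreeGroup (Fin n), x = .of ⟨i, by omega⟩ := ⟨_, rfl⟩
  obtain ⟨y, hy⟩ : ∃ y : FreeGroup (Fin n), y = .of ⟨j, hj⟩ := ⟨_, rfl⟩
  obtain ⟨w, hw⟩ : ∃ w, w = y⁻¹ * x * y := ⟨_, rfl⟩
  obtain ⟨u, hu⟩ : ∃ u, u = x⁻¹ * w := ⟨_, rfl⟩
  have hθ := artin_sigmaPure_of hij hj (hx := hx) (hy := hy) (hw := hw) (hu := hu)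
  have hc : ∀ v, M (i + 1) (j + 1) * g v
      = g (artin n (sigmaPure n i j) v) * M (i + 1) (j + 1) := fun v => by
    refine Units.ext ?_
    rw [h1]
    exact rho_conj rho (sigmaPure n i j) v
  have h0' : ∀ l : Fin n, g (.of l) = M 0 (l.1 + 1) := fun l => (h0 l).symm
  have hgx : g x = M 0 (i + 1) := by rw [hx, h0']
  have hgy : g y = M 0 (j + 1) := by rw [hy, h0']
  set m := M (i + 1) (j + 1) with hm
  set a := M 0 (i + 1) with ha
  set b := M 0 (j + 1) with hb
  have hxw : g w * m = m * a := by
    rw [← hgx, hc, hx, hθ, if_pos rfl]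
  have hum : g u * m = a⁻¹ * m * a := by
    rw [hu, map_mul, map_inv, hgx, mul_assoc, hxw, mul_assoc]
  have hmab : m * a * b = b * m * a := by
    have h := hc y
    rw [hy, hθ, if_neg (by dsimp only; omega), if_pos rfl, ← hy, map_mul, map_mul, map_inv,
      mul_assoc, hxw, hgy, mul_assoc, eq_inv_mul_iff_mul_eq, ← mul_assoc, hxw] at h
    rw [h, mul_assoc]
  have hfw : ∀ r : Fin n, fox g w r * m =
      if r.1 = i then (b * m : A) else if r.1 = j then (m * (1 - a) : A) else 0 := fun r => by
    rw [hw, fox_inv_mul_mul, ← hw, add_mul, mul_assoc, sub_mul, one_mul, ← Units.val_mul, hxw,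
      hgy, hx, hy, fox_of, fox_of, Units.val_mul]
    obtain ⟨r, hr⟩ := r
    by_cases r1 : r = i
    · subst r1; simp [hij.ne]
    by_cases r2 : r = j
    · subst r2; simp [r1, mul_sub]
    simp [r1, r2]
  have hfu : ∀ r : Fin n, fox g u r * m =
      if r.1 = i then (b * m - (a⁻¹ : Aˣ) * m * a : A)
      else if r.1 = j then (m * (1 - a) : A) else 0 := fun r => by
    have e : fox g u r * m = fox g w r * m - fox g x r * (a⁻¹ * (g w * m) : Aˣ) := by
      rw [hu, fox_mul, fox_inv, hgx]
      simp only [Units.val_mul]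
      noncomm_ring
    rw [e, hfw, hxw, hx, fox_of]
    obtain ⟨r, hr⟩ := r
    by_cases r1 : r = i
    · subst r1; simp [mul_assoc]
    · simp [r1]
  ext r c
  rw [lmMatrix, Matrix.mul_diagonal, ← h1, foxMatrix, Matrix.of_apply, ← hg, hθ]
  have hcc := hc (.of c)
  rw [hθ, h0'] at hcc
  simp only [haraokaMatrix, Matrix.of_apply, Nat.add_right_cancel_iff, Nat.add_lt_add_iff_right,
    Nat.succ_ne_zero, if_false, ← hm, ← ha, ← hb]
  by_cases c1 : c.1 = i
  · rw [if_pos c1, hfw]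
    simp only [c1, hij.ne, hij, lt_irrefl, if_true, if_false, false_and]
    split_ifs <;> rfl
  by_cases c2 : c.1 = j
  · rw [if_neg c1, if_pos c2] at hcc ⊢
    rw [fox_inv_mul_mul, add_mul, mul_assoc, sub_mul, one_mul, ← Units.val_mul, ← hcc, c2, ← hb,
      mul_assoc, ← Units.val_mul, hxw]
    have e : fox g w r * (m - (m * b : Aˣ) : A) = fox g w r * m * (1 - b) := by
      rw [Units.val_mul]; noncomm_ring
    rw [e, hfw, hy, fox_of, Pi.single_apply]
    simp only [Fin.ext_iff]
    by_cases r1 : r.1 = i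
    · simp [r1, hij.ne, hij.ne']
    by_cases r2 : r.1 = j
    · have e2 : (m * a * b : A) = b * m * a := by
        simpa only [Units.val_mul] using congrArg Units.val hmab
      simp [r2, hij.ne', ← e2]
      noncomm_ring
    simp [r1, r2]
  by_cases c3 : i < c.1 ∧ c.1 < j
  · rw [if_neg c1, if_neg c2, if_pos c3] at hcc ⊢
    rw [fox_inv_mul_mul, add_mul, mul_assoc, sub_mul, one_mul, ← Units.val_mul, ← hcc,
      mul_assoc, ← Units.val_mul, hum]
    have e : fox g u r * (m - (m * M 0 (c.1 + 1) : Aˣ) : A)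
        = fox g u r * m * (1 - M 0 (c.1 + 1)) := by
      rw [Units.val_mul]; noncomm_ring
    rw [e, hfu, fox_of, Pi.single_apply]
    simp only [Fin.ext_iff]
    by_cases r1 : r.1 = i
    · simp [r1, Ne.symm c1, c1, c3]
    by_cases r2 : r.1 = j
    · simp [r2, hij.ne', Ne.symm c2, c1, c3]
    by_cases r3 : r.1 = c.1
    · simp [r3, c1, c2, c3]
    simp [r1, r2, r3]
  rw [if_neg c1, if_neg c2, if_neg c3, fox_of, Pi.single_apply]
  simp only [Fin.ext_iff, c1, c2, c3, if_false]
  by_cases r3 : r.1 = c.1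
  · simp [r3, c1, c2, c3]
  · simp [r3]

/-- The matrix `N_{0j}` is the Dettweiler–Reiter matrix of `x_j`. -/
theorem drMatrix_eq_haraokaMatrix {k A : Type*} [CommRing k] [Ring A] [Algebra k A] (lam : kˣ)
    {n : ℕ} (g : FreeGroup (Fin n) →* Aˣ) (M : ℕ → ℕ → Aˣ)
    (h0 : ∀ l : Fin n, M 0 (l.1 + 1) = g (.of l)) (j : Fin n) :
    drMatrix lam g j = haraokaMatrix lam n M 0 (j.1 + 1) := by
  ext r c
  simp only [drMatrix, haraokaMatrix, Matrix.of_apply, Nat.add_right_cancel_iff,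
    Nat.add_lt_add_iff_right, if_true, ← Fin.ext_iff, ← Fin.lt_def, h0]
  by_cases hc : c = j
  · simp [hc]
  · simp [hc]

/-! ### Comparison with Haraoka's convolution -/

theorem isHaraokaConvolution_pureLM {k V : Type*} [Field k] [AddCommGroup V] [Module k V]
    (n : ℕ) (lam : kˣ) (rho : pureBraid (n + 1) →* LinearMap.GeneralLinearGroup k V) :
    IsHaraokaConvolution lam (opHom rho) (opHom (pureLM lam rho)) := by
  set M : ℕ → ℕ → (Module.End k V)ˣ := fun a b => rho (sigmaPure (n + 1) a b)
  set rho' : FreeSemidirect n (pureBraid n) →* (Module.End k V)ˣ :=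
    rho.comp (pureBraidEquiv n).symm.toMonoidHom with hrho
  have hrho' : ∀ b, rho' (pureBraidEquiv n b) = rho b := fun b => by
    rw [hrho]
    exact congrArg rho ((pureBraidEquiv n).symm_apply_apply b)
  have h0 : ∀ l : Fin n, M 0 (l.1 + 1) = rho' (SemidirectProduct.inl (.of l)) := fun l => by
    rw [← pureBraidEquiv_zero, hrho']
  intro i j hij hj
  change (endVecRingEquivMatrixEnd (Fin n) k V).symm
      (twistedLM lam rho' (pureBraidEquiv n (sigmaPure (n + 1) i j))).val =
    (endVecRingEquivMatrixEnd (Fin n) k V).symm (haraokaMatrix lam n M i j)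
  congr 1
  obtain ⟨j, rfl⟩ : ∃ l, j = l + 1 := ⟨j - 1, by omega⟩
  cases i with
  | zero =>
    rw [pureBraidEquiv_zero n ⟨j, hj⟩, twistedLM_inl]
    exact drMatrix_eq_haraokaMatrix lam _ M h0 ⟨j, hj⟩
  | succ i =>
    rw [pureBraidEquiv_pos n i j (by omega) hj, twistedLM_inr]
    exact lmMatrix_sigmaPure lam (by omega) hj rho' M h0
      (by rw [← pureBraidEquiv_pos n i j (by omega) hj, hrho'])

/-- An anti-representation of `P_{n+1}` is determined by its values on the `σ̃_{ij}`. -/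
theorem IsHaraokaConvolution.eq {k V : Type*} [Field k] [AddCommGroup V] [Module k V]
    {n : ℕ} {lam : kˣ} {eta : pureBraid (n + 1) →* (LinearMap.GeneralLinearGroup k V)ᵐᵒᵖ}
    {S T : pureBraid (n + 1) →* (LinearMap.GeneralLinearGroup k (Fin n → V))ᵐᵒᵖ}
    (hS : IsHaraokaConvolution lam eta S) (hT : IsHaraokaConvolution lam eta T) : S = T := by
  refine MonoidHom.eq_of_eqOn_dense (closure_sigmaPure (n + 1)) ?_
  rintro _ ⟨i, j, hij, hj, rfl⟩
  have h : S (sigmaTilde (n + 1) i j) = T (sigmaTilde (n + 1) i j) :=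
    MulOpposite.unop_injective (Units.ext
      ((hS i j hij (by omega)).trans (hT i j hij (by omega)).symm))
  rw [sigmaPure, map_inv, map_inv, h]

end HaraokaLong

theorem mainTheorem1 {k V : Type*} [Field k] [AddCommGroup V] [Module k V]
    [FiniteDimensional k V] (n : ℕ) (lam : kˣ)
    (rho : pureBraid (n + 1) →* LinearMap.GeneralLinearGroup k V) :
    IsHaraokaConvolution lam (opHom rho) (opHom (pureLM lam rho)) ∧
      ∀ T : pureBraid (n + 1) →* (LinearMap.GeneralLinearGroup k (Fin n → V))ᵐᵒᵖ,
        IsHaraokaConvolution lam (opHom rho) T → T = opHom (pureLM lam rho) :=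
  ⟨isHaraokaConvolution_pureLM n lam rho,
    fun _ hT => hT.eq (isHaraokaConvolution_pureLM n lam rho)⟩
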